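/- Let $\mathbb K$ be an algebraically closed field of characteristic $0$, $X$ a smooth affine algebraic variety over $\mathbb K$, $\mathcal O=\mathcal O_X(X)$ its coordinate ring, $\Theta=\mathrm{Der}_{\mathbb K}(\mathcal O)$ its vector fields and $\mathcal D=\mathcal D_X(X)$ its ring of differential operators, i.e. the subalgebra of $\mathrm{End}_{\mathbb K}(\mathcal O)$ generated by $\mathcal O$ and $\Theta$. A differential graded $\mathcal D$-algebra is a non-negatively graded, graded-commutative, unital $\mathcal O$-algebra $A=\bigoplus_{n\ge 0}A_n$ with a degree-preserving $\mathcal D$-module structure (a flat connection $\nabla$ extending the $\mathcal O$-module structure) for which vector fields act as derivations, and with a $\mathcal D$-linear differential $d_A$ of degree $-1$, $d_A^2=0$, which is a graded derivation. The category $\mathtt{DG}\mathcal D\mathtt A$ has these objects, and as morphisms the degree-preserving unital algebra maps that are $\mathcal D$-linear and commute with the differentials. A weak equivalence is a morphism that induces an isomorphism in homology; a fibration is a morphism that is surjective in all degrees $n>0$. For a differential graded $\mathcal D$-module $M$, $\mathcal S M$ denotes the free graded-commutative $\mathcal O$-algebra on $M$ (the quotient of the tensor algebra $\bigotimes_{\mathcal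 O}^{*}M$ by the relations $m\otimes m'=(-1)^{|m||m'|}m'\otimes m$), with the induced differential and $\mathcal D$-action; tensor products are over $\mathcal O$, with the usual Koszul signs, and vector fields act on them by $\nabla_\theta\otimes\mathrm{id}+\mathrm{id}\otimes\nabla_\theta$. A relative Sullivan $\mathcal D$-algebra is a morphism $A\to(A\otimes\mathcal S V,d)$, $a\mapsto a\otimes 1$, of $\mathtt{DG}\mathcal D\mathtt A$, where $V=\bigoplus_{\alpha\in J}\mathcal D\cdot v_\alpha$ is a free non-negatively graded $\mathcal D$-module with a homogeneous basis indexed by a well-ordered set $J$, $A\otimes\mathcal S V$ carries its canonical graded $\mathcal D$-algebra structure, and the differential $d$ satisfies $d v_\alpha\in A\otimes\mathcal S V_{<\alpha}$ for all $\alpha$, with $V_{<\alpha}=\bigoplus_{\beta<\alpha}\mathcal D\cdot v_\beta$. It is minimal if $\alpha\le\beta$ implies $\deg v_\alpha\le\deg v_\beta$, and split if $d=d_A\otimes\mathrm{id}+\mathrm{id}\otimes d_{\mathcal S}$ for some differential $d_{\mathcal S}$ on $\mathcal S V$. For $B\in\mathtt{DG}\mathcal D\mathtt A$ let $$P(B)=\bigoplus_{n>0}\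 \bigoplus_{b\in B_n}D^n_{(b)},\qquad D^n_{(b)}=\bigl(\cdots\to 0\to\mathcal D\cdot\mathbb I_b\to\mathcal D\cdot s^{-1}\mathbb I_b\to 0\to\cdots\bigr),$$ where $\mathbb I_b$ has degree $n$, $s^{-1}\mathbb I_b$ has degree $n-1$, and the $\mathcal D$-linear differential is given by $d\,\mathbb I_b=s^{-1}\mathbb I_b$ and $d\,s^{-1}\mathbb I_b=0$. Theorem. Every $\mathtt{DG}\mathcal D\mathtt A$-morphism $\varphi:A\to B$ factors as $\varphi=p\circ i$, where $i:A\to A\otimes\mathcal S(P(B))$, $a\mapsto a\otimes 1$, is a weak equivalence and a split minimal relative Sullivan $\mathcal D$-algebra (with $V=P(B)$, whose basis consists of the generators $\mathbb I_b$, $s^{-1}\mathbb I_b$ in a suitable well-ordering), and $p:A\otimes\mathcal S(P(B))\to B$ is a fibration. These factorizations are functorial: they are the values of a functorial factorization on the category of morphisms of $\mathtt{DG}\mathcal D\mathtt A$. -/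

import Mathlib

open CategoryTheory
open scoped TensorProduct DirectSum

universe v u

namespace DAlg

noncomputable section

/-! ### The ring of differential operators -/

section DiffOp

variable (K : Type v) (O : Type u) [CommRing K] [CommRing O] [Algebra K O]

/-- The `K`-subalgebra of `End_K(O)` generated by the functions `f ∈ O` (acting by multiplication)
and the vector fields `θ ∈ Der_K(O)`. -/
def diffOpSubalgebra : Subalgebra K (Module.End K O) :=
  Algebra.adjoin K
    (Set.range (fun f : O => LinearMap.mulLeft K f) ∪
      Set.range (fun θ : Derivation K O O => (θ : O →ₗ[K] O)))

/-- The ring `𝒟` of differential operators of the affine variety with coordinate ring `O`. -/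
def DiffOp : Type u := diffOpSubalgebra K O

instance : Ring (DiffOp K O) := inferInstanceAs (Ring (diffOpSubalgebra K O))

/-- A function as a differential operator of order zero. -/
def DiffOp.ofFun : O →+* DiffOp K O where
  toFun f := ⟨LinearMap.mulLeft K f, Algebra.subset_adjoin (Or.inl ⟨f, rfl⟩)⟩
  map_one' := Subtype.ext (by ext; simp; rfl)
  map_mul' f g := Subtype.ext (by ext x; exact mul_assoc f g x)
  map_zero' := Subtype.ext (by ext; simp; rfl)
  map_add' f g := Subtype.ext (by ext x; exact add_mul f g x)

variable {O} in
/-- A vector field as a differential operator. -/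
def DiffOp.ofField (θ : Derivation K O O) : DiffOp K O :=
  ⟨(θ : O →ₗ[K] O), Algebra.subset_adjoin (Or.inr ⟨θ, rfl⟩)⟩

/-- `𝒟` as a module over the functions, by left multiplication. -/
instance : Module O (DiffOp K O) := Module.compHom _ (DiffOp.ofFun K O)

variable {O}

theorem DiffOp.smul_def (f : O) (P : DiffOp K O) : f • P = DiffOp.ofFun K O f * P := rfl

theorem DiffOp.ofField_add (θ θ' : Derivation K O O) :
    DiffOp.ofField K (θ + θ') = DiffOp.ofField K θ + DiffOp.ofField K θ' := rfl

theorem DiffOp.ofField_smul (f : O) (θ : Derivation K O O) :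
    DiffOp.ofField K (f • θ) = DiffOp.ofFun K O f * DiffOp.ofField K θ := rfl

theorem DiffOp.ofField_bracket (θ θ' : Derivation K O O) :
    DiffOp.ofField K ⁅θ, θ'⁆ =
      DiffOp.ofField K θ * DiffOp.ofField K θ' - DiffOp.ofField K θ' * DiffOp.ofField K θ := by
  refine Subtype.ext (LinearMap.ext fun x => ?_)
  exact Derivation.commutator_apply (D1 := θ) (D2 := θ') x

theorem DiffOp.ofField_mul_ofFun (θ : Derivation K O O) (f : O) :
    DiffOp.ofField K θ * DiffOp.ofFun K O f =
      DiffOp.ofFun K O f * DiffOp.ofField K θ + DiffOp.ofFun K O (θ f) := by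
  refine Subtype.ext (LinearMap.ext fun x => ?_)
  change θ (f * x) = f * θ x + θ f * x
  rw [Derivation.leibniz]; simp [mul_comm]

end DiffOp

/-! ### Graded `𝒟`-modules -/

section Modules

variable (K : Type v) (O : Type u) [CommRing K] [CommRing O] [Algebra K O]

/-- A left `𝒟`-module structure extending an `O`-module structure on `M`, that is, a flat
connection. (`K`-linearity of `∇` in both arguments follows from the axioms `smul` and
`leibniz`.) -/
structure FlatConnection (M : Type u) [AddCommGroup M] [Module O M] where
  nabla : Derivation K O O → M →+ M
  add : ∀ θ θ' m, nabla (θ + θ') m = nabla θ m + nabla θ' m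
  smul : ∀ (f : O) θ m, nabla (f • θ) m = f • nabla θ m
  leibniz : ∀ θ (f : O) m, nabla θ (f • m) = f • nabla θ m + θ f • m
  bracket : ∀ θ θ' m, nabla ⁅θ, θ'⁆ m = nabla θ (nabla θ' m) - nabla θ' (nabla θ m)

variable {K O} in
/-- `d` is a `𝒟`-linear differential of degree `-1` on a non-negatively graded `𝒟`-module. -/
structure IsDifferential {M : Type u} [AddCommGroup M] [Module O M] (gr : ℕ → Submodule O M)
    (conn : FlatConnection K O M) (d : M →ₗ[O] M) : Prop where
  map_succ : ∀ n, ∀ m ∈ gr (n + 1), d m ∈ gr n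
  map_zero : ∀ m ∈ gr 0, d m = 0
  sq : ∀ m, d (d m) = 0
  comm : ∀ θ m, d (conn.nabla θ m) = conn.nabla θ (d m)

/-- Non-negatively graded `𝒟`-modules `M = ⨁ₙ Mₙ`. -/
structure GDM where
  carrier : Type u
  [addCommGroup : AddCommGroup carrier]
  [module : Module O carrier]
  gr : ℕ → Submodule O carrier
  [decomposition : DirectSum.Decomposition gr]
  conn : FlatConnection K O carrier
  conn_mem : ∀ θ n, ∀ m ∈ gr n, conn.nabla θ m ∈ gr n

attribute [instance] GDM.addCommGroup GDM.module GDM.decomposition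

variable {K O} in
/-- Differentials on a graded `𝒟`-module. -/
structure GDM.Differential (M : GDM K O) where
  d : M.carrier →ₗ[O] M.carrier
  isDifferential : IsDifferential M.gr M.conn d

/-- Differential non-negatively graded `𝒟`-modules. -/
structure DGDM extends GDM K O where
  diff : toGDM.Differential

/-! ### Differential graded `𝒟`-algebras -/

/-- Non-negatively graded, graded-commutative, unital `𝒟`-algebras: graded-commutative `O`-algebras
with a degree-preserving flat connection for which vector fields act as (non-graded)
derivations. -/
structure GDA where
  carrier : Type u
  [ring : Ring carrier]
  [algebra : Algebra O carrier]
  gr : ℕ → Submodule O carrier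
  [graded : GradedAlgebra gr]
  conn : FlatConnection K O carrier
  conn_mem : ∀ θ n, ∀ a ∈ gr n, conn.nabla θ a ∈ gr n
  conn_mul : ∀ θ a b, conn.nabla θ (a * b) = conn.nabla θ a * b + a * conn.nabla θ b
  mul_comm : ∀ m n, ∀ a ∈ gr m, ∀ b ∈ gr n, a * b = (-1 : O) ^ (m * n) • (b * a)

attribute [instance] GDA.ring GDA.algebra GDA.graded

variable {K O} in
/-- Differentials on a graded `𝒟`-algebra: `𝒟`-linear, of degree `-1`, of square zero, and graded
derivations. -/
structure GDA.Differential (A : GDA K O) where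
  d : A.carrier →ₗ[O] A.carrier
  isDifferential : IsDifferential A.gr A.conn d
  leibniz : ∀ n, ∀ a ∈ A.gr n, ∀ b, d (a * b) = d a * b + (-1 : O) ^ n • (a * d b)

/-- Differential non-negatively graded commutative `𝒟`-algebras. -/
structure DGDA extends GDA K O where
  diff : toGDA.Differential

variable {K O}

/-- Morphisms of graded `𝒟`-algebras. -/
structure GDA.Hom (A B : GDA K O) where
  toAlgHom : A.carrier →ₐ[O] B.carrier
  map_mem : ∀ n, ∀ a ∈ A.gr n, toAlgHom a ∈ B.gr n
  map_conn : ∀ θ a, toAlgHom (A.conn.nabla θ a) = B.conn.nabla θ (toAlgHom a)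

/-- Morphisms of differential graded `𝒟`-algebras. -/
@[ext]
structure DGDA.Hom (A B : DGDA K O) extends GDA.Hom A.toGDA B.toGDA where
  map_d : ∀ a, toAlgHom (A.diff.d a) = B.diff.d (toAlgHom a)

/-- The category `DG𝒟A`. -/
instance : Category (DGDA K O) where
  Hom A B := DGDA.Hom A B
  id A := ⟨⟨AlgHom.id O A.carrier, fun _ _ h => h, fun _ _ => rfl⟩, fun _ => rfl⟩
  comp f g := ⟨⟨g.toAlgHom.comp f.toAlgHom,
    fun n a h => g.map_mem n _ (f.map_mem n a h),
    fun θ a => by simp [f.map_conn, g.map_conn]⟩,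
    fun a => by simp [f.map_d, g.map_d]⟩

/-! ### Weak equivalences and fibrations -/

/-- The homology `H(A) = ker d / im d` of a differential graded `𝒟`-algebra. -/
abbrev DGDA.Homology (A : DGDA K O) : Type u :=
  LinearMap.ker A.diff.d ⧸ (LinearMap.range A.diff.d).submoduleOf (LinearMap.ker A.diff.d)

/-- The map induced in homology. -/
def DGDA.homologyMap {A B : DGDA K O} (f : A ⟶ B) : A.Homology →ₗ[O] B.Homology :=
  Submodule.mapQ _ _
    (f.toAlgHom.toLinearMap.restrict (p := LinearMap.ker A.diff.d) (q := LinearMap.ker B.diff.d)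
      (fun a (ha : A.diff.d a = 0) => by
        change B.diff.d (f.toAlgHom a) = 0
        rw [← f.map_d, ha, map_zero]))
    (by
      rintro ⟨a, ha⟩ ⟨b, hb⟩
      exact ⟨f.toAlgHom b, by rw [← f.map_d, hb]; rfl⟩)

variable (K O) in
/-- Weak equivalences: morphisms that induce an isomorphism in homology. -/
def weakEquivalences : MorphismProperty (DGDA K O) :=
  fun _ _ f => Function.Bijective (DGDA.homologyMap f)

variable (K O) in
/-- Fibrations: morphisms that are surjective in all positive degrees. -/
def fibrations : MorphismProperty (DGDA K O) :=
  fun A B f => ∀ n, 0 < n → ∀ b ∈ B.gr n, ∃ a ∈ A.gr n, f.toAlgHom a = b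

end Modules

/-! ### The graded symmetric algebra -/

section Sym

variable {K : Type v} {O : Type u} [CommRing K] [CommRing O] [Algebra K O]
variable {M : Type u} [AddCommGroup M] [Module O M] (gr : ℕ → Submodule O M)

/-- The map `m ↦ (-1)ⁿ m` for `m` of degree `n`. -/
def signMap [DirectSum.Decomposition gr] : M →ₗ[O] M :=
  DirectSum.toModule O ℕ M (fun n => (-1 : O) ^ n • (gr n).subtype) ∘ₗ
    (DirectSum.decomposeLinearEquiv gr).toLinearMap

variable {gr} in
theorem signMap_of_mem [DirectSum.Decomposition gr] {n : ℕ} {m : M} (hm : m ∈ gr n) :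
    signMap gr m = (-1 : O) ^ n • m := by
  simp only [signMap, LinearMap.comp_apply, LinearEquiv.coe_coe,
    DirectSum.decomposeLinearEquiv_apply]
  rw [DirectSum.decompose_of_mem _ hm, ← DirectSum.lof_eq_of O, DirectSum.toModule_lof]
  rfl

/-- Graded commutativity of the product of homogeneous generators. -/
inductive GSym.Rel : TensorAlgebra O M → TensorAlgebra O M → Prop
  | comm (m n : ℕ) (a b : M) (ha : a ∈ gr m) (hb : b ∈ gr n) :
      GSym.Rel (TensorAlgebra.ι O a * TensorAlgebra.ι O b)
        ((-1 : O) ^ (m * n) • (TensorAlgebra.ι O b * TensorAlgebra.ι O a))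

/-- The graded symmetric algebra `𝒮_O(M)`: the quotient of the tensor algebra of `M` over `O` by
the ideal generated by the elements `a ⊗ b - (-1)^{mn} b ⊗ a`, `a ∈ M_m`, `b ∈ M_n`. -/
def GSym : Type u := RingQuot (GSym.Rel gr)

namespace GSym

instance : Ring (GSym gr) := inferInstanceAs (Ring (RingQuot (GSym.Rel gr)))

instance : Algebra O (GSym gr) := inferInstanceAs (Algebra O (RingQuot (GSym.Rel gr)))

/-- The canonical inclusion of `M` in `𝒮_O(M)`. -/
def ι : M →ₗ[O] GSym gr :=
  (RingQuot.mkAlgHom O (GSym.Rel gr)).toLinearMap ∘ₗ TensorAlgebra.ι O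

variable {gr}

theorem ι_mul_ι {m n : ℕ} {a b : M} (ha : a ∈ gr m) (hb : b ∈ gr n) :
    ι gr a * ι gr b = (-1 : O) ^ (m * n) • (ι gr b * ι gr a) := by
  have := RingQuot.mkAlgHom_rel O (Rel.comm (gr := gr) m n a b ha hb)
  rw [map_mul, map_smul, map_mul] at this
  exact this

/-- The universal property of `𝒮_O(M)`. -/
def lift {E : Type*} [Ring E] [Algebra O E] (f : M →ₗ[O] E)
    (hf : ∀ m n, ∀ a ∈ gr m, ∀ b ∈ gr n, f a * f b = (-1 : O) ^ (m * n) • (f b * f a)) :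
    GSym gr →ₐ[O] E :=
  RingQuot.liftAlgHom O ⟨TensorAlgebra.lift O f, by
    rintro _ _ ⟨m, n, a, b, ha, hb⟩
    simpa using hf m n a ha b hb⟩

theorem lift_ι {E : Type*} [Ring E] [Algebra O E] (f : M →ₗ[O] E) (hf) (m : M) :
    lift (gr := gr) f hf (ι gr m) = f m := by
  have := RingQuot.liftAlgHom_mkAlgHom_apply O (TensorAlgebra.lift O f) (s := GSym.Rel gr) (by
    rintro _ _ ⟨m, n, a, b, ha, hb⟩
    simpa using hf m n a ha b hb) (TensorAlgebra.ι O m)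
  rw [TensorAlgebra.lift_ι_apply] at this
  exact this

theorem hom_ext {E : Type*} [Ring E] [Algebra O E] {f g : GSym gr →ₐ[O] E}
    (h : ∀ m, f (ι gr m) = g (ι gr m)) : f = g := by
  apply RingQuot.ringQuot_ext' (S := O)
  apply TensorAlgebra.hom_ext
  ext m
  exact h m

variable (gr) in
/-- Products `m₁ ⊙ ⋯ ⊙ m_k` of homogeneous elements of `M` of total degree `n`. -/
inductive IsMonomial : ℕ → GSym gr → Prop
  | one : IsMonomial 0 1
  | mul (k n : ℕ) (m : M) (x : GSym gr) (hm : m ∈ gr k) (hx : IsMonomial n x) :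
      IsMonomial (k + n) (ι gr m * x)

variable (gr) in
/-- The grading of `𝒮_O(M)` induced by that of `M`. -/
def grading (n : ℕ) : Submodule O (GSym gr) :=
  Submodule.span O {x | IsMonomial gr n x}

theorem IsMonomial.mul' {m n : ℕ} {x y : GSym gr} (hx : IsMonomial gr m x)
    (hy : IsMonomial gr n y) : IsMonomial gr (m + n) (x * y) := by
  induction hx with
  | one => simpa using hy
  | mul k l a x ha _ ih =>
    rw [add_assoc, mul_assoc]
    exact .mul k _ a _ ha ih

theorem ι_mem {n : ℕ} {m : M} (hm : m ∈ gr n) : ι gr m ∈ grading gr n := by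
  have := IsMonomial.mul n 0 m 1 hm .one
  rw [add_zero, mul_one] at this
  exact Submodule.subset_span this

instance : SetLike.GradedMonoid (grading gr) where
  one_mem := Submodule.subset_span .one
  mul_mem := by
    intro i j x y hx hy
    have h : grading gr i * grading gr j ≤ grading gr (i + j) := by
      rw [grading, grading, Submodule.span_mul_span, Submodule.span_le]
      rintro _ ⟨x, hx, y, hy, rfl⟩
      exact Submodule.subset_span (IsMonomial.mul' hx hy)
    exact h (Submodule.mul_mem_mul hx hy)

theorem monomial_comm {m n : ℕ} {x y : GSym gr} (hx : IsMonomial gr m x)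
    (hy : IsMonomial gr n y) : x * y = (-1 : O) ^ (m * n) • (y * x) := by
  have key : ∀ {k n : ℕ} {a : M} {y : GSym gr}, a ∈ gr k → IsMonomial gr n y →
      ι gr a * y = (-1 : O) ^ (k * n) • (y * ι gr a) := by
    intro k n a y ha hy
    induction hy with
    | one => simp
    | mul l n b y hb _ ih =>
      rw [← mul_assoc, ι_mul_ι ha hb, smul_mul_assoc, mul_assoc, ih, mul_smul_comm, smul_smul,
        mul_add, pow_add, mul_assoc]
  induction hx with
  | one => simp
  | mul k l a x ha _ ih =>
    rw [mul_assoc, ih, mul_smul_comm, ← mul_assoc, key ha hy, smul_mul_assoc, smul_smul, mul_assoc,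
      add_mul, pow_add, mul_comm ((-1 : O) ^ _)]

theorem mul_comm' (m n : ℕ) (x : GSym gr) (hx : x ∈ grading gr m) (y : GSym gr)
    (hy : y ∈ grading gr n) : x * y = (-1 : O) ^ (m * n) • (y * x) := by
  induction hx using Submodule.span_induction with
  | zero => simp
  | add x x' _ _ h h' => rw [add_mul, mul_add, h, h', smul_add]
  | smul c x _ h => rw [smul_mul_assoc, mul_smul_comm, h, smul_comm]
  | mem x hx =>
    induction hy using Submodule.span_induction with
    | zero => simp
    | add x x' _ _ h h' => rw [add_mul, mul_add, h, h', smul_add]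
    | smul c x _ h => rw [smul_mul_assoc, mul_smul_comm, h, smul_comm]
    | mem y hy => exact monomial_comm hx hy

/-- `𝒮_O(M)` is generated by the homogeneous elements of `M`. -/
theorem induction [DirectSum.Decomposition gr] {p : GSym gr → Prop}
    (hO : ∀ f : O, p (algebraMap O _ f)) (hι : ∀ n, ∀ m ∈ gr n, p (ι gr m))
    (hmul : ∀ x y, p x → p y → p (x * y)) (hadd : ∀ x y, p x → p y → p (x + y))
    (x : GSym gr) : p x := by
  obtain ⟨t, rfl⟩ := RingQuot.mkAlgHom_surjective O (Rel gr) x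
  induction t using TensorAlgebra.induction with
  | algebraMap r => rw [AlgHom.commutes]; exact hO r
  | ι m =>
    change p (ι gr m)
    induction m using DirectSum.Decomposition.inductionOn gr with
    | zero => simpa using hO 0
    | homogeneous m => exact hι _ _ m.2
    | add m m' h h' => rw [map_add]; exact hadd _ _ h h'
  | mul a b ha hb => rw [map_mul]; exact hmul _ _ ha hb
  | add a b ha hb => rw [map_add]; exact hadd _ _ ha hb

variable (gr)

/-- The degree components of the canonical inclusion. -/
def decomposeAux [DirectSum.Decomposition gr] : M →ₗ[O] ⨁ n, grading gr n :=
  DirectSum.toModule O ℕ (⨁ n, grading gr n) (fun n =>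
      DirectSum.lof O ℕ (fun n => grading gr n) n ∘ₗ
      ((ι gr).restrict (p := gr n) (q := grading gr n) fun _ => ι_mem)) ∘ₗ
      (DirectSum.decomposeLinearEquiv gr).toLinearMap

theorem decomposeAux_apply [DirectSum.Decomposition gr] {n : ℕ} {m : M} (hm : m ∈ gr n) :
    decomposeAux gr m = DirectSum.of (fun n => grading gr n) n ⟨ι gr m, ι_mem hm⟩ := by
  simp only [decomposeAux, LinearMap.comp_apply, LinearEquiv.coe_coe,
    DirectSum.decomposeLinearEquiv_apply]
  rw [DirectSum.decompose_of_mem _ hm, ← DirectSum.lof_eq_of O, DirectSum.toModule_lof]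
  rfl

/-- The decomposition map `𝒮_O(M) → ⨁ₙ 𝒮_O(M)ₙ`. -/
def decomposeHom [DirectSum.Decomposition gr] : GSym gr →ₐ[O] ⨁ n, grading gr n :=
  lift (gr := gr) (E := ⨁ n, grading gr n) (decomposeAux gr) (by
    intro m n a ha b hb
    rw [decomposeAux_apply gr ha, decomposeAux_apply gr hb, DirectSum.of_mul_of,
      DirectSum.of_mul_of, ← DirectSum.lof_eq_of O, ← DirectSum.lof_eq_of O, ← map_smul,
      DirectSum.lof_eq_of, DirectSum.lof_eq_of]
    refine DirectSum.of_eq_of_gradedMonoid_eq (Sigma.subtype_ext (add_comm m n) ?_)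
    exact ι_mul_ι ha hb)

theorem decomposeHom_ι [DirectSum.Decomposition gr] {n : ℕ} {m : M} (hm : m ∈ gr n) :
    decomposeHom gr (ι gr m) = DirectSum.of (fun n => grading gr n) n ⟨ι gr m, ι_mem hm⟩ := by
  rw [decomposeHom, lift_ι, decomposeAux_apply gr hm]

theorem decomposeHom_monomial [DirectSum.Decomposition gr] {n : ℕ} {x : GSym gr}
    (hx : IsMonomial gr n x) : decomposeHom gr x =
      DirectSum.of (fun n => grading gr n) n ⟨x, Submodule.subset_span hx⟩ := by
  induction hx with
  | one => rw [map_one]; rfl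
  | mul k n m x hm hx ih =>
    rw [map_mul, ih, decomposeHom_ι gr hm, DirectSum.of_mul_of]
    rfl

instance [DirectSum.Decomposition gr] : GradedAlgebra (grading gr) :=
  GradedAlgebra.ofAlgHom (grading gr) (decomposeHom gr)
    (by
      refine AlgHom.ext fun x => ?_
      induction x using induction with
      | hO f => simp only [AlgHom.commutes]
      | hι n m hm =>
        rw [AlgHom.comp_apply, decomposeHom_ι gr hm]
        exact DirectSum.coeAlgHom_of _ _ _
      | hmul x y hx hy => rw [map_mul, hx, hy, map_mul]
      | hadd x y hx hy => rw [map_add, hx, hy, map_add])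
    (by
      rintro n ⟨x, hx⟩
      change decomposeHom gr x = _
      induction hx using Submodule.span_induction with
      | mem x hx => exact decomposeHom_monomial gr hx
      | zero => rw [map_zero]; exact (map_zero (DirectSum.of (fun n => grading gr n) n)).symm
      | add x y hx hy h h' =>
        rw [map_add, h, h', ← map_add]; rfl
      | smul c x hx h =>
        rw [map_smul, h, ← DirectSum.lof_eq_of O, ← map_smul]; rfl)

/-- The dual numbers `𝒮_O(M)[ε]`, seen as an `O`-algebra through `f ↦ f + θ(f) ε`. -/
def Twist (_ : Derivation K O O) : Type u := DualNumber (GSym gr)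

instance (θ : Derivation K O O) : Ring (Twist gr θ) := inferInstanceAs (Ring (DualNumber (GSym gr)))

variable {gr} in
/-- The element `x + y ε`. -/
def Twist.mk (θ : Derivation K O O) (x y : GSym gr) : Twist gr θ :=
  (TrivSqZeroExt.inl x + TrivSqZeroExt.inr y : DualNumber (GSym gr))

variable {gr} in
/-- The coefficient `x` of `x + y ε`. -/
def Twist.fst {θ : Derivation K O O} (z : Twist gr θ) : GSym gr :=
  TrivSqZeroExt.fst (R := GSym gr) (M := GSym gr) z

variable {gr} in
/-- The coefficient `y` of `x + y ε`. -/
def Twist.snd {θ : Derivation K O O} (z : Twist gr θ) : GSym gr :=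
  TrivSqZeroExt.snd (R := GSym gr) (M := GSym gr) z

namespace Twist

variable {gr}

variable {θ : Derivation K O O}

theorem ext {z w : Twist gr θ} (h : z.fst = w.fst) (h' : z.snd = w.snd) : z = w :=
  TrivSqZeroExt.ext h h'

@[simp] theorem fst_mk (x y : GSym gr) : (mk θ x y).fst = x := by
  simp [mk, fst]

@[simp] theorem snd_mk (x y : GSym gr) : (mk θ x y).snd = y := by
  simp [mk, snd]

@[simp] theorem fst_one : (1 : Twist gr θ).fst = 1 := rfl

@[simp] theorem snd_one : (1 : Twist gr θ).snd = 0 := rfl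

@[simp] theorem fst_zero : (0 : Twist gr θ).fst = 0 := rfl

@[simp] theorem snd_zero : (0 : Twist gr θ).snd = 0 := rfl

@[simp] theorem fst_add (z w : Twist gr θ) : (z + w).fst = z.fst + w.fst := rfl

@[simp] theorem snd_add (z w : Twist gr θ) : (z + w).snd = z.snd + w.snd := rfl

@[simp] theorem fst_mul (z w : Twist gr θ) : (z * w).fst = z.fst * w.fst := rfl

@[simp] theorem snd_mul (z w : Twist gr θ) :
    (z * w).snd = z.fst * w.snd + z.snd * w.fst := rfl

instance : Algebra O (Twist gr θ) :=
  RingHom.toAlgebra'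
    { toFun := fun f => mk θ (algebraMap O (GSym gr) f) (algebraMap O (GSym gr) (θ f))
      map_one' := ext (by simp) (by simp)
      map_zero' := ext (by simp) (by simp)
      map_add' := fun f g => ext (by simp) (by simp)
      map_mul' := fun f g => ext (by simp) (by
        simp only [snd_mul, snd_mk, fst_mk, Derivation.leibniz, smul_eq_mul, map_add, map_mul]
        rw [Algebra.commutes g]) }
    (fun f z => ext (by
      change (mk θ _ _ * z).fst = (z * mk θ _ _).fst
      simp [Algebra.commutes]) (by
      change (mk θ _ _ * z).snd = (z * mk θ _ _).snd
      simp [Algebra.commutes, add_comm]))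

theorem algebraMap_eq (f : O) :
    algebraMap O (Twist gr θ) f = mk θ (algebraMap O _ f) (algebraMap O _ (θ f)) := rfl

end Twist

/-! The sign automorphism, the differential and the connection of `𝒮_O(M)`. -/

variable [DirectSum.Decomposition gr]

/-- The algebra morphism `x ↦ (-1)ⁿ x` for `x` of degree `n`. -/
def sign : GSym gr →ₐ[O] GSym gr :=
  lift (ι gr ∘ₗ signMap gr) (by
    intro m n a ha b hb
    simp only [LinearMap.comp_apply, signMap_of_mem ha, signMap_of_mem hb, map_smul,
      smul_mul_assoc, mul_smul_comm, ι_mul_ι ha hb]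
    simp only [smul_smul]; congr 1; ring)

theorem sign_ι {n : ℕ} {m : M} (hm : m ∈ gr n) : sign gr (ι gr m) = (-1 : O) ^ n • ι gr m := by
  rw [sign, lift_ι, LinearMap.comp_apply, signMap_of_mem hm, map_smul]

theorem sign_of_mem {n : ℕ} {x : GSym gr} (hx : x ∈ grading gr n) :
    sign gr x = (-1 : O) ^ n • x := by
  induction hx using Submodule.span_induction with
  | mem x hx =>
    induction hx with
    | one => simp
    | mul k n m x hm hx ih =>
      rw [map_mul, ih, sign_ι gr hm, smul_mul_smul_comm, pow_add]
  | zero => simp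
  | add x y _ _ h h' => rw [map_add, h, h', smul_add]
  | smul c x _ h => rw [map_smul, h, smul_comm]

variable {gr}
variable {conn : FlatConnection K O M} {d : M →ₗ[O] M} (hd : IsDifferential gr conn d)

/-- Auxiliary morphism `x ↦ ((±x, dx), (0, x))`. -/
def dHom : GSym gr →ₐ[O] Matrix (Fin 2) (Fin 2) (GSym gr) :=
  lift
    { toFun := fun m => !![ι gr (signMap gr m), ι gr (d m); 0, ι gr m]
      map_add' := fun a b => by ext i j; fin_cases i <;> fin_cases j <;> simp
      map_smul' := fun c a => by ext i j; fin_cases i <;> fin_cases j <;> simp }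
    (by
      intro m n a ha b hb
      have h1 : ι gr a * ι gr (d b) = ((-1 : O) ^ (m * n) * (-1 : O) ^ m) • (ι gr (d b) * ι gr a) := by
        rcases n with _ | n
        · simp [hd.map_zero b hb]
        · rw [ι_mul_ι ha (hd.map_succ n b hb), mul_add, pow_add, mul_assoc, mul_one, ← pow_add,
            ← two_mul, pow_mul]
          simp
      have h2 : ι gr (d a) * ι gr b = ((-1 : O) ^ (m * n) * (-1 : O) ^ n) • (ι gr b * ι gr (d a)) := by
        rcases m with _ | m
        · simp [hd.map_zero a ha]
        · rw [ι_mul_ι (hd.map_succ m a ha) hb, add_mul, pow_add, mul_assoc, one_mul, ← pow_add,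
            ← two_mul, pow_mul]
          simp
      have h3 := ι_mul_ι ha hb
      have h4 : ι gr (signMap gr a) = (-1 : O) ^ m • ι gr a := by
        rw [signMap_of_mem ha, map_smul]
      have h5 : ι gr (signMap gr b) = (-1 : O) ^ n • ι gr b := by
        rw [signMap_of_mem hb, map_smul]
      have hm : (-1 : O) ^ m * (-1 : O) ^ m = 1 := by
        rw [← pow_add, ← two_mul, pow_mul]; simp
      ext i j
      fin_cases i <;> fin_cases j
      · simp only [LinearMap.coe_mk, AddHom.coe_mk, h4, h5, Matrix.smul_of, Matrix.smul_cons,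
          Matrix.mul_fin_two]
        simp [h3, smul_smul, mul_assoc, mul_comm]
        congr 1; ring
      · simp [h4, h5, h1, h2, smul_smul]
        rw [add_comm, mul_left_comm, hm, mul_one]
      · simp
      · simpa using h3)

theorem dHom_ι (m : M) :
    dHom hd (ι gr m) = !![ι gr (signMap gr m), ι gr (d m); 0, ι gr m] := by
  rw [dHom, lift_ι]; rfl

theorem dHom_apply (x : GSym gr) :
    dHom hd x 0 0 = sign gr x ∧ dHom hd x 1 0 = 0 ∧ dHom hd x 1 1 = x := by
  induction x using induction with
  | hO f => simp [Matrix.algebraMap_matrix_apply]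
  | hι n m hm => simp [dHom_ι, sign, lift_ι]
  | hmul x y hx hy =>
    simp [Matrix.mul_apply, Fin.sum_univ_two, hx, hy]
  | hadd x y hx hy => simp [hx, hy]

/-- The graded derivation of `𝒮_O(M)` that extends the differential `d` of `M`. -/
def symD : GSym gr →ₗ[O] GSym gr where
  toFun x := dHom hd x 0 1
  map_add' x y := by simp
  map_smul' c x := by simp

theorem symD_ι (m : M) : symD hd (ι gr m) = ι gr (d m) := by
  change dHom hd _ 0 1 = _
  simp [dHom_ι]

theorem symD_algebraMap (f : O) : symD hd (algebraMap O _ f) = 0 := by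
  change dHom hd _ 0 1 = _
  simp [Matrix.algebraMap_matrix_apply]

theorem symD_mul (x y : GSym gr) : symD hd (x * y) = symD hd x * y + sign gr x * symD hd y := by
  change dHom hd _ 0 1 = dHom hd _ 0 1 * _ + _ * dHom hd _ 0 1
  rw [map_mul, Matrix.mul_apply, Fin.sum_univ_two, (dHom_apply hd x).1, (dHom_apply hd y).2.2,
    add_comm]

theorem symD_sign (x : GSym gr) : symD hd (sign gr x) = - sign gr (symD hd x) := by
  induction x using induction with
  | hO f => simp [symD_algebraMap]
  | hι n m hm =>
    rw [sign_ι gr hm, map_smul, symD_ι]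
    rcases n with _ | n
    · simp [hd.map_zero m hm]
    · rw [sign_ι gr (hd.map_succ n m hm), pow_succ]; simp
  | hmul x y hx hy => simp only [map_mul, symD_mul, hx, hy, map_add]; noncomm_ring
  | hadd x y hx hy => simp only [map_add, hx, hy, neg_add]

theorem symD_sq (x : GSym gr) : symD hd (symD hd x) = 0 := by
  induction x using induction with
  | hO f => simp [symD_algebraMap]
  | hι n m hm => rw [symD_ι, symD_ι, hd.sq, map_zero]
  | hmul x y hx hy => simp [symD_mul, hx, hy, symD_sign]
  | hadd x y hx hy => simp only [map_add, hx, hy, add_zero]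

theorem symD_monomial {n : ℕ} {x : GSym gr} (hx : IsMonomial gr n x) :
    (n = 0 → symD hd x = 0) ∧ ∀ k, n = k + 1 → symD hd x ∈ grading gr k := by
  induction hx with
  | one =>
    have : symD hd (1 : GSym gr) = 0 := by simpa using symD_algebraMap hd (gr := gr) 1
    simp [this]
  | mul l n m x hm hx ih =>
    rw [symD_mul, symD_ι, sign_ι gr hm]
    refine ⟨fun h => ?_, fun k h => Submodule.add_mem _ ?_ ?_⟩
    · obtain ⟨rfl, rfl⟩ : l = 0 ∧ n = 0 := by omega
      simp [hd.map_zero m hm, ih.1 rfl]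
    · rcases l with _ | l
      · simp [hd.map_zero m hm]
      · obtain rfl : k = l + n := by omega
        exact SetLike.GradedMul.mul_mem (ι_mem (hd.map_succ l m hm)) (Submodule.subset_span hx)
    · rcases n with _ | n
      · simp [ih.1 rfl]
      · obtain rfl : k = l + n := by omega
        exact SetLike.GradedMul.mul_mem (Submodule.smul_mem _ _ (ι_mem hm)) (ih.2 n rfl)

theorem symD_mem_succ (n : ℕ) (x : GSym gr) (hx : x ∈ grading gr (n + 1)) :
    symD hd x ∈ grading gr n := by
  induction hx using Submodule.span_induction with
  | mem x hx => exact (symD_monomial hd hx).2 n rfl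
  | zero => simp
  | add x y _ _ h h' => rw [map_add]; exact Submodule.add_mem _ h h'
  | smul c x _ h => rw [map_smul]; exact Submodule.smul_mem _ _ h

theorem symD_mem_zero (x : GSym gr) (hx : x ∈ grading gr 0) : symD hd x = 0 := by
  induction hx using Submodule.span_induction with
  | mem x hx => exact (symD_monomial hd hx).1 rfl
  | zero => simp
  | add x y _ _ h h' => rw [map_add, h, h', add_zero]
  | smul c x _ h => rw [map_smul, h, smul_zero]

theorem symD_leibniz (n : ℕ) (x : GSym gr) (hx : x ∈ grading gr n) (y : GSym gr) :
    symD hd (x * y) = symD hd x * y + (-1 : O) ^ n • (x * symD hd y) := by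
  rw [symD_mul, sign_of_mem gr hx, smul_mul_assoc]

section Conn

variable (hconn : ∀ θ n, ∀ m ∈ gr n, conn.nabla θ m ∈ gr n)

/-- Auxiliary morphism `x ↦ x + ∇_θ(x) ε`. -/
def nablaHom (θ : Derivation K O O) : GSym gr →ₐ[O] Twist gr θ :=
  lift
    { toFun := fun m => Twist.mk θ (ι gr m) (ι gr (conn.nabla θ m))
      map_add' := fun a b => Twist.ext (by simp) (by simp)
      map_smul' := fun c a => by
        rw [RingHom.id_apply, Algebra.smul_def, Twist.algebraMap_eq]
        exact Twist.ext (by simp [Algebra.smul_def]) (by simp [conn.leibniz, Algebra.smul_def]) }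
    (by
      intro m n a ha b hb
      have h1 := ι_mul_ι ha hb
      have h2 := ι_mul_ι ha (hconn θ n b hb)
      have h3 := ι_mul_ι (hconn θ m a ha) hb
      have hθ : θ ((-1) ^ (m * n)) = 0 := by simp [Derivation.leibniz_pow]
      rw [Algebra.smul_def, Twist.algebraMap_eq, hθ]
      exact Twist.ext (by simpa [Algebra.smul_def] using h1)
        (by simp [h2, h3, Algebra.smul_def, mul_add, add_comm]))

theorem nablaHom_ι (θ : Derivation K O O) (m : M) :
    nablaHom hconn θ (ι gr m) = Twist.mk θ (ι gr m) (ι gr (conn.nabla θ m)) := by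
  rw [nablaHom, lift_ι]; rfl

theorem nablaHom_fst (θ : Derivation K O O) (x : GSym gr) : (nablaHom hconn θ x).fst = x := by
  induction x using induction with
  | hO f => simp [Twist.algebraMap_eq]
  | hι n m hm => simp [nablaHom_ι]
  | hmul x y hx hy => simp [hx, hy]
  | hadd x y hx hy => simp [hx, hy]

/-- The derivation of `𝒮_O(M)` that extends the action of `θ` on `M`. -/
def nabla (θ : Derivation K O O) : GSym gr →+ GSym gr where
  toFun x := (nablaHom hconn θ x).snd
  map_zero' := by simp
  map_add' x y := by simp

theorem nabla_ι (θ : Derivation K O O) (m : M) :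
    nabla hconn θ (ι gr m) = ι gr (conn.nabla θ m) := by
  change (nablaHom hconn θ _).snd = _
  simp [nablaHom_ι]

theorem nabla_algebraMap (θ : Derivation K O O) (f : O) :
    nabla hconn θ (algebraMap O _ f) = algebraMap O _ (θ f) := by
  change (nablaHom hconn θ _).snd = _
  simp [Twist.algebraMap_eq]

theorem nabla_mul (θ : Derivation K O O) (x y : GSym gr) :
    nabla hconn θ (x * y) = nabla hconn θ x * y + x * nabla hconn θ y := by
  change (nablaHom hconn θ _).snd = (nablaHom hconn θ _).snd * _ + _ * (nablaHom hconn θ _).snd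
  simp [nablaHom_fst, add_comm]

/-- The flat connection of `𝒮_O(M)`. -/
def symConn : FlatConnection K O (GSym gr) where
  nabla := nabla hconn
  add θ θ' x := by
    induction x using induction with
    | hO f => simp [nabla_algebraMap]
    | hι n m hm => simp [nabla_ι, conn.add]
    | hmul x y hx hy => simp only [nabla_mul, hx, hy]; noncomm_ring
    | hadd x y hx hy => simp only [map_add, hx, hy]; abel
  smul f θ x := by
    induction x using induction with
    | hO g => simp [nabla_algebraMap, Algebra.smul_def]
    | hι n m hm => simp [nabla_ι, conn.smul]
    | hmul x y hx hy => simp only [nabla_mul, hx, hy, smul_add, smul_mul_assoc, mul_smul_comm]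
    | hadd x y hx hy => simp only [map_add, hx, hy, smul_add]
  leibniz θ f x := by
    rw [Algebra.smul_def, nabla_mul, nabla_algebraMap, Algebra.smul_def, Algebra.smul_def, add_comm]
  bracket θ θ' x := by
    induction x using induction with
    | hO f => simp [nabla_algebraMap, Derivation.commutator_apply]
    | hι n m hm => simp [nabla_ι, conn.bracket]
    | hmul x y hx hy => simp only [nabla_mul, map_add, hx, hy]; noncomm_ring
    | hadd x y hx hy => simp only [map_add, hx, hy]; abel

theorem nabla_mem (θ : Derivation K O O) (n : ℕ) (x : GSym gr) (hx : x ∈ grading gr n) :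
    nabla hconn θ x ∈ grading gr n := by
  induction hx using Submodule.span_induction with
  | mem x hx =>
    induction hx with
    | one =>
      have : nabla hconn θ (1 : GSym gr) = 0 := by
        simpa using nabla_algebraMap hconn (gr := gr) θ 1
      simp [this]
    | mul l n m x hm hx ih =>
      rw [nabla_mul, nabla_ι]
      exact Submodule.add_mem _
        (SetLike.GradedMul.mul_mem (ι_mem (hconn θ l m hm)) (Submodule.subset_span hx))
        (SetLike.GradedMul.mul_mem (ι_mem hm) ih)
  | zero => simp
  | add x y _ _ h h' => rw [map_add]; exact Submodule.add_mem _ h h'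
  | smul c x hx h =>
    have := (symConn hconn).leibniz θ c x
    change nabla hconn θ (c • x) = c • nabla hconn θ x + θ c • x at this
    rw [this]
    exact Submodule.add_mem _ (Submodule.smul_mem _ _ h) (Submodule.smul_mem _ _ hx)

theorem nabla_sign (θ : Derivation K O O) (x : GSym gr) :
    nabla hconn θ (sign gr x) = sign gr (nabla hconn θ x) := by
  induction x using induction with
  | hO f => simp [nabla_algebraMap]
  | hι n m hm => 
    have hθ : θ ((-1) ^ n) = 0 := by simp [Derivation.leibniz_pow]
    rw [sign_ι gr hm, nabla_ι, sign_ι gr (hconn θ n m hm), ← map_smul, nabla_ι, conn.leibniz, hθ]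
    simp
  | hmul x y hx hy => simp only [map_mul, nabla_mul, hx, hy, map_add]
  | hadd x y hx hy => simp only [map_add, hx, hy]

theorem symD_nabla (θ : Derivation K O O) (x : GSym gr) :
    symD hd (nabla hconn θ x) = nabla hconn θ (symD hd x) := by
  induction x using induction with
  | hO f => simp [nabla_algebraMap, symD_algebraMap]
  | hι n m hm => simp [nabla_ι, symD_ι, hd.comm]
  | hmul x y hx hy => simp only [symD_mul, nabla_mul, hx, hy, map_add, nabla_sign]; abel
  | hadd x y hx hy => simp only [map_add, hx, hy]

end Conn

end GSym

/-- The graded symmetric algebra of a graded `𝒟`-module, with its graded `𝒟`-algebra structure. -/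
abbrev GDM.sym (M : GDM K O) : GDA K O where
  carrier := GSym M.gr
  gr := GSym.grading M.gr
  conn := GSym.symConn M.conn_mem
  conn_mem := GSym.nabla_mem M.conn_mem
  conn_mul := GSym.nabla_mul M.conn_mem
  mul_comm := GSym.mul_comm'

/-- The differential on `𝒮_O(M)` induced by a differential on `M`. -/
abbrev GDM.Differential.sym {M : GDM K O} (δ : M.Differential) : M.sym.Differential where
  d := GSym.symD δ.isDifferential
  isDifferential :=
    { map_succ := GSym.symD_mem_succ _
      map_zero := GSym.symD_mem_zero _
      sq := GSym.symD_sq _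
      comm := GSym.symD_nabla _ M.conn_mem }
  leibniz := GSym.symD_leibniz _

/-- The free differential graded `𝒟`-algebra `𝒮(M)` over a differential graded `𝒟`-module. -/
abbrev DGDM.sym (M : DGDM K O) : DGDA K O where
  toGDA := M.toGDM.sym
  diff := M.diff.sym

end Sym

/-! ### Tensor products -/

section Tensor

variable {K : Type v} {O : Type u} [CommRing K] [CommRing O] [Algebra K O]
variable {A B : Type u} [Ring A] [Ring B] [Algebra O A] [Algebra O B]
variable (𝒜 : ℕ → Submodule O A) (ℬ : ℕ → Submodule O B) [GradedAlgebra 𝒜] [GradedAlgebra ℬ]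

namespace Tens

/-- The degree `n` component of `A ⊗_O B`. -/
def grading (n : ℕ) : Submodule O (𝒜 ᵍ⊗[O] ℬ) :=
  Submodule.span O {x | ∃ i j, i + j = n ∧ ∃ a ∈ 𝒜 i, ∃ b ∈ ℬ j, a ᵍ⊗ₜ[O] b = x}

variable {𝒜 ℬ}

theorem tmul_mem {i j : ℕ} {a : A} {b : B} (ha : a ∈ 𝒜 i) (hb : b ∈ ℬ j) :
    a ᵍ⊗ₜ[O] b ∈ grading 𝒜 ℬ (i + j) :=
  Submodule.subset_span ⟨i, j, rfl, a, ha, b, hb, rfl⟩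

theorem add_tmul (a a' : A) (b : B) :
    ((a + a') ᵍ⊗ₜ[O] b : 𝒜 ᵍ⊗[O] ℬ) = a ᵍ⊗ₜ[O] b + a' ᵍ⊗ₜ[O] b :=
  TensorProduct.add_tmul a a' b

theorem tmul_add (a : A) (b b' : B) :
    (a ᵍ⊗ₜ[O] (b + b') : 𝒜 ᵍ⊗[O] ℬ) = a ᵍ⊗ₜ[O] b + a ᵍ⊗ₜ[O] b' :=
  TensorProduct.tmul_add a b b'

theorem smul_tmul' (c : O) (a : A) (b : B) :
    ((c • a) ᵍ⊗ₜ[O] b : 𝒜 ᵍ⊗[O] ℬ) = c • a ᵍ⊗ₜ[O] b := rfl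

theorem tmul_smul (c : O) (a : A) (b : B) :
    (a ᵍ⊗ₜ[O] (c • b) : 𝒜 ᵍ⊗[O] ℬ) = c • a ᵍ⊗ₜ[O] b :=
  TensorProduct.tmul_smul c a b

theorem zero_tmul (b : B) : ((0 : A) ᵍ⊗ₜ[O] b : 𝒜 ᵍ⊗[O] ℬ) = 0 := TensorProduct.zero_tmul A b

theorem tmul_zero (a : A) : (a ᵍ⊗ₜ[O] (0 : B) : 𝒜 ᵍ⊗[O] ℬ) = 0 := TensorProduct.tmul_zero B a

theorem induction {p : 𝒜 ᵍ⊗[O] ℬ → Prop} (zero : p 0) (add : ∀ x y, p x → p y → p (x + y))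
    (tmul : ∀ i j, ∀ a ∈ 𝒜 i, ∀ b ∈ ℬ j, p (a ᵍ⊗ₜ[O] b)) (x : 𝒜 ᵍ⊗[O] ℬ) : p x := by
  induction x using TensorProduct.induction_on with
  | zero => exact zero
  | add x y hx hy => exact add x y hx hy
  | tmul a b =>
    change p (a ᵍ⊗ₜ[O] b)
    induction a using DirectSum.Decomposition.inductionOn 𝒜 with
    | zero => rw [zero_tmul]; exact zero
    | add a a' h h' => rw [add_tmul]; exact add _ _ h h'
    | homogeneous a =>
      induction b using DirectSum.Decomposition.inductionOn ℬ with
      | zero => rw [tmul_zero]; exact zero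
      | add a a' h h' => rw [tmul_add]; exact add _ _ h h'
      | homogeneous b => exact tmul _ _ _ a.2 _ b.2

theorem sign_smul {N : Type*} [AddCommGroup N] [Module O N] (k : ℕ) (x : N) :
    ((-1 : ℤˣ) ^ k) • x = (-1 : O) ^ k • x := by
  rcases Nat.even_or_odd k with h | h <;> simp [h.neg_one_pow]

/-- The Koszul sign rule `(a₁ ⊗ b₁)(a₂ ⊗ b₂) = (-1)^{|b₁||a₂|} a₁a₂ ⊗ b₁b₂`. -/
theorem tmul_mul {i j : ℕ} (a₁ : A) {b₁ : B} (hb : b₁ ∈ ℬ j) {a₂ : A} (ha : a₂ ∈ 𝒜 i) (b₂ : B) :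
    (a₁ ᵍ⊗ₜ[O] b₁ * a₂ ᵍ⊗ₜ[O] b₂ : 𝒜 ᵍ⊗[O] ℬ) = (-1 : O) ^ (j * i) • (a₁ * a₂) ᵍ⊗ₜ[O] (b₁ * b₂) := by
  have := GradedTensorProduct.tmul_coe_mul_coe_tmul (R := O) (𝒜 := 𝒜) (ℬ := ℬ) a₁ ⟨b₁, hb⟩ ⟨a₂, ha⟩ b₂
  rw [← sign_smul]
  exact this

instance : SetLike.GradedMonoid (grading 𝒜 ℬ) where
  one_mem := Submodule.subset_span
    ⟨0, 0, rfl, 1, SetLike.GradedOne.one_mem, 1, SetLike.GradedOne.one_mem, rfl⟩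
  mul_mem := by
    intro m n x y hx hy
    have h : grading 𝒜 ℬ m * grading 𝒜 ℬ n ≤ grading 𝒜 ℬ (m + n) := by
      rw [grading, grading, Submodule.span_mul_span, Submodule.span_le]
      rintro _ ⟨_, ⟨i, j, rfl, a, ha, b, hb, rfl⟩, _, ⟨i', j', rfl, a', ha', b', hb', rfl⟩, rfl⟩
      change a ᵍ⊗ₜ[O] b * a' ᵍ⊗ₜ[O] b' ∈ _
      rw [tmul_mul a hb ha' b', add_add_add_comm]
      exact Submodule.smul_mem _ _
        (tmul_mem (SetLike.GradedMul.mul_mem ha ha') (SetLike.GradedMul.mul_mem hb hb'))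
    exact h (Submodule.mul_mem_mul hx hy)

theorem mul_comm' (m n : ℕ)
    (hA : ∀ m n, ∀ a ∈ 𝒜 m, ∀ b ∈ 𝒜 n, a * b = (-1 : O) ^ (m * n) • (b * a))
    (hB : ∀ m n, ∀ a ∈ ℬ m, ∀ b ∈ ℬ n, a * b = (-1 : O) ^ (m * n) • (b * a))
    (x : 𝒜 ᵍ⊗[O] ℬ) (hx : x ∈ grading 𝒜 ℬ m) (y : 𝒜 ᵍ⊗[O] ℬ) (hy : y ∈ grading 𝒜 ℬ n) :
    x * y = (-1 : O) ^ (m * n) • (y * x) := by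
  induction hx using Submodule.span_induction with
  | zero => simp
  | add x x' _ _ h h' => rw [add_mul, mul_add, h, h', smul_add]
  | smul c x _ h => rw [smul_mul_assoc, mul_smul_comm, h, smul_comm]
  | mem x hx =>
    induction hy using Submodule.span_induction with
    | zero => simp
    | add x x' _ _ h h' => rw [add_mul, mul_add, h, h', smul_add]
    | smul c x _ h => rw [smul_mul_assoc, mul_smul_comm, h, smul_comm]
    | mem y hy =>
      obtain ⟨i, j, rfl, a, ha, b, hb, rfl⟩ := hx
      obtain ⟨i', j', rfl, a', ha', b', hb', rfl⟩ := hy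
      rw [tmul_mul a hb ha' b', tmul_mul a' hb' ha b, hA i i' a ha a' ha', hB j j' b hb b' hb',
        smul_tmul', tmul_smul, smul_smul, smul_smul, smul_smul]
      congr 1
      have : (-1 : O) ^ (i * j') * (-1 : O) ^ (i * j') = 1 := by
        rw [← pow_add, ← two_mul, pow_mul]; simp
      linear_combination (exp := 1) (-(-1 : O) ^ (j * i') * (-1) ^ (i * i') * (-1) ^ (j * j')) * this

/-- The bilinear map `𝒜 i × ℬ j → (A ⊗ B)_{i+j}`. -/
def tmulHom (i j : ℕ) : 𝒜 i →ₗ[O] ℬ j →ₗ[O] ⨁ n, grading 𝒜 ℬ n :=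
  LinearMap.mk₂ O (fun a b => DirectSum.lof O ℕ (fun n => grading 𝒜 ℬ n) (i + j)
      ⟨(a : A) ᵍ⊗ₜ[O] (b : B), tmul_mem a.2 b.2⟩)
    (fun a a' b => by rw [← map_add]; congr 1; exact Subtype.ext (add_tmul _ _ _))
    (fun c a b => by rw [← map_smul]; rfl)
    (fun a b b' => by rw [← map_add]; congr 1; exact Subtype.ext (tmul_add _ _ _))
    (fun c a b => by rw [← map_smul]; congr 1; exact Subtype.ext (tmul_smul _ _ _))

variable (𝒜 ℬ) in
/-- The decomposition map of `A ⊗_O B`. -/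
def decomposeHom : (𝒜 ᵍ⊗[O] ℬ) →ₗ[O] ⨁ n, grading 𝒜 ℬ n :=
  TensorProduct.lift (DirectSum.toModule O ℕ _ fun i =>
    (DirectSum.toModule O ℕ _ fun j => (tmulHom i j).flip).flip) ∘ₗ
    (GradedTensorProduct.auxEquiv O 𝒜 ℬ).toLinearMap

theorem decomposeHom_tmul {i j : ℕ} {a : A} {b : B} (ha : a ∈ 𝒜 i) (hb : b ∈ ℬ j) :
    decomposeHom 𝒜 ℬ (a ᵍ⊗ₜ[O] b) =
      DirectSum.lof O ℕ (fun n => grading 𝒜 ℬ n) (i + j) ⟨a ᵍ⊗ₜ[O] b, tmul_mem ha hb⟩ := by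
  rw [decomposeHom, LinearMap.comp_apply, LinearEquiv.coe_coe, GradedTensorProduct.auxEquiv_tmul,
    DirectSum.decompose_of_mem _ ha, DirectSum.decompose_of_mem _ hb, TensorProduct.lift.tmul,
    ← DirectSum.lof_eq_of O, ← DirectSum.lof_eq_of O, DirectSum.toModule_lof, LinearMap.flip_apply,
    DirectSum.toModule_lof]
  rfl

instance : DirectSum.Decomposition (grading 𝒜 ℬ) :=
  DirectSum.Decomposition.ofLinearMap (grading 𝒜 ℬ) (decomposeHom 𝒜 ℬ)
    (by
      refine LinearMap.ext fun x => ?_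
      induction x using induction with
      | zero => simp
      | add x y hx hy => rw [map_add, hx, hy, map_add]
      | tmul i j a ha b hb =>
        rw [LinearMap.comp_apply, decomposeHom_tmul ha hb]
        exact DirectSum.coeLinearMap_lof _ _ _)
    (by
      refine DirectSum.linearMap_ext _ fun n => LinearMap.ext ?_
      rintro ⟨x, hx⟩
      rw [LinearMap.comp_apply, LinearMap.comp_apply, DirectSum.coeLinearMap_lof]
      change decomposeHom 𝒜 ℬ x = DirectSum.lof O ℕ (fun n => grading 𝒜 ℬ n) n ⟨x, hx⟩
      induction hx using Submodule.span_induction with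
      | mem x hx =>
        obtain ⟨i, j, rfl, a, ha, b, hb, rfl⟩ := hx
        exact decomposeHom_tmul ha hb
      | zero => rw [map_zero]; exact (map_zero (DirectSum.lof O ℕ (fun n => grading 𝒜 ℬ n) n)).symm
      | add x y hx hy h h' => rw [map_add, h, h', ← map_add]; rfl
      | smul c x hx h => rw [map_smul, h, ← map_smul]; rfl)

instance : GradedAlgebra (grading 𝒜 ℬ) :=
  { (inferInstance : SetLike.GradedMonoid (grading 𝒜 ℬ)),
    (inferInstance : DirectSum.Decomposition (grading 𝒜 ℬ)) with }

section Conn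

variable (cA : FlatConnection K O A) (cB : FlatConnection K O B)

variable (𝒜 ℬ) in
/-- `∇_θ (a ⊗ b) = ∇_θ a ⊗ b + a ⊗ ∇_θ b`. -/
def nabla (θ : Derivation K O O) : (𝒜 ᵍ⊗[O] ℬ) →+ (𝒜 ᵍ⊗[O] ℬ) :=
  TensorProduct.liftAddHom (R := O) (M := A) (N := B) (P := 𝒜 ᵍ⊗[O] ℬ)
    (AddMonoidHom.mk' (fun a => AddMonoidHom.mk'
        (fun b => cA.nabla θ a ᵍ⊗ₜ[O] b + a ᵍ⊗ₜ[O] cB.nabla θ b)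
        (fun b b' => by rw [map_add, tmul_add, tmul_add]; abel))
      (fun a a' => AddMonoidHom.ext fun b => by
        simp only [AddMonoidHom.mk'_apply, AddMonoidHom.add_apply, map_add, add_tmul]; abel))
    (fun f a b => by
      simp only [AddMonoidHom.mk'_apply, cA.leibniz, cB.leibniz, tmul_add, add_tmul, smul_tmul',
        tmul_smul]
      abel)

theorem nabla_tmul (θ : Derivation K O O) (a : A) (b : B) :
    nabla 𝒜 ℬ cA cB θ (a ᵍ⊗ₜ[O] b) = cA.nabla θ a ᵍ⊗ₜ[O] b + a ᵍ⊗ₜ[O] cB.nabla θ b := rfl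

variable (𝒜 ℬ) in
/-- The flat connection of `A ⊗_O B`. -/
def conn : FlatConnection K O (𝒜 ᵍ⊗[O] ℬ) where
  nabla := nabla 𝒜 ℬ cA cB
  add θ θ' x := by
    induction x using induction with
    | zero => simp
    | add x y hx hy => simp only [map_add, hx, hy]; abel
    | tmul i j a ha b hb => simp only [nabla_tmul, cA.add, cB.add, add_tmul, tmul_add]; abel
  smul f θ x := by
    induction x using induction with
    | zero => simp
    | add x y hx hy => simp only [map_add, hx, hy, smul_add]
    | tmul i j a ha b hb =>
      simp only [nabla_tmul, cA.smul, cB.smul, smul_tmul', tmul_smul, smul_add]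
  leibniz θ f x := by
    induction x using induction with
    | zero => simp
    | add x y hx hy => simp only [map_add, hx, hy, smul_add]; abel
    | tmul i j a ha b hb =>
      rw [← smul_tmul', nabla_tmul, cA.leibniz, nabla_tmul, add_tmul]
      simp only [smul_tmul', smul_add]
      abel
  bracket θ θ' x := by
    induction x using induction with
    | zero => simp
    | add x y hx hy => simp only [map_add, hx, hy]; abel
    | tmul i j a ha b hb =>
      simp only [nabla_tmul, cA.bracket, cB.bracket, map_add]
      simp only [GradedTensorProduct.tmul, TensorProduct.sub_tmul, TensorProduct.tmul_sub, map_sub]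
      abel

theorem nabla_mem (hA : ∀ θ n, ∀ m ∈ 𝒜 n, cA.nabla θ m ∈ 𝒜 n)
    (hB : ∀ θ n, ∀ m ∈ ℬ n, cB.nabla θ m ∈ ℬ n) (θ : Derivation K O O) (n : ℕ)
    (x : 𝒜 ᵍ⊗[O] ℬ) (hx : x ∈ grading 𝒜 ℬ n) :
    nabla 𝒜 ℬ cA cB θ x ∈ grading 𝒜 ℬ n := by
  induction hx using Submodule.span_induction with
  | mem x hx =>
    obtain ⟨i, j, rfl, a, ha, b, hb, rfl⟩ := hx
    exact Submodule.add_mem _ (tmul_mem (hA θ i a ha) hb) (tmul_mem ha (hB θ j b hb))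
  | zero => simp
  | add x y _ _ h h' => rw [map_add]; exact Submodule.add_mem _ h h'
  | smul c x hx h =>
    have := (conn 𝒜 ℬ cA cB).leibniz θ c x
    change nabla 𝒜 ℬ cA cB θ (c • x) = c • nabla 𝒜 ℬ cA cB θ x + θ c • x at this
    rw [this]
    exact Submodule.add_mem _ (Submodule.smul_mem _ _ h) (Submodule.smul_mem _ _ hx)

theorem nabla_mul (hA : ∀ θ n, ∀ m ∈ 𝒜 n, cA.nabla θ m ∈ 𝒜 n)
    (hB : ∀ θ n, ∀ m ∈ ℬ n, cB.nabla θ m ∈ ℬ n)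
    (hA' : ∀ θ a b, cA.nabla θ (a * b) = cA.nabla θ a * b + a * cA.nabla θ b)
    (hB' : ∀ θ a b, cB.nabla θ (a * b) = cB.nabla θ a * b + a * cB.nabla θ b)
    (θ : Derivation K O O) (x y : 𝒜 ᵍ⊗[O] ℬ) :
    nabla 𝒜 ℬ cA cB θ (x * y) = nabla 𝒜 ℬ cA cB θ x * y + x * nabla 𝒜 ℬ cA cB θ y := by
  induction x using induction with
  | zero => simp
  | add x x' hx hx' => simp only [add_mul, map_add, hx, hx']; abel
  | tmul i j a ha b hb =>
    induction y using induction with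
    | zero => simp
    | add x x' hx hx' => simp only [mul_add, map_add, hx, hx']; abel
    | tmul i' j' a' ha' b' hb' =>
      have hθ : θ ((-1) ^ (j * i')) = 0 := by simp [Derivation.leibniz_pow]
      have := (conn 𝒜 ℬ cA cB).leibniz θ ((-1) ^ (j * i')) ((a * a') ᵍ⊗ₜ[O] (b * b'))
      change nabla 𝒜 ℬ cA cB θ _ = _ • nabla 𝒜 ℬ cA cB θ _ + _ at this
      rw [tmul_mul a hb ha' b', this, hθ, zero_smul, add_zero]
      simp only [nabla_tmul, add_mul, mul_add]
      rw [tmul_mul _ hb ha' b', tmul_mul _ (hB θ j b hb) ha' b', tmul_mul _ hb (hA θ i' a' ha') b',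
        tmul_mul _ hb ha' _, hA', hB']
      simp only [add_tmul, tmul_add, smul_add]
      abel

end Conn

section Diff

variable {cA : FlatConnection K O A} {cB : FlatConnection K O B}
variable (dA : A →ₗ[O] A) (dB : B →ₗ[O] B)

variable (𝒜 ℬ) in
/-- `d (a ⊗ b) = da ⊗ b + (-1)^{|a|} a ⊗ db`. -/
def diff : (𝒜 ᵍ⊗[O] ℬ) →ₗ[O] (𝒜 ᵍ⊗[O] ℬ) :=
  (GradedTensorProduct.of O 𝒜 ℬ).toLinearMap ∘ₗ
    (TensorProduct.map dA LinearMap.id + TensorProduct.map (signMap 𝒜) dB) ∘ₗ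
    (GradedTensorProduct.of O 𝒜 ℬ).symm.toLinearMap

theorem diff_tmul {i : ℕ} {a : A} (ha : a ∈ 𝒜 i) (b : B) :
    diff 𝒜 ℬ dA dB (a ᵍ⊗ₜ[O] b) = dA a ᵍ⊗ₜ[O] b + (-1 : O) ^ i • a ᵍ⊗ₜ[O] dB b := by
  rw [← smul_tmul', ← signMap_of_mem ha]; rfl

variable {dA dB}

theorem diff_isDifferential (hA : IsDifferential 𝒜 cA dA) (hB : IsDifferential ℬ cB dB)
    (hcA : ∀ θ n, ∀ m ∈ 𝒜 n, cA.nabla θ m ∈ 𝒜 n) :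
    IsDifferential (grading 𝒜 ℬ) (conn 𝒜 ℬ cA cB) (diff 𝒜 ℬ dA dB) where
  map_succ n x hx := by
    refine Submodule.span_induction (p := fun x _ => diff 𝒜 ℬ dA dB x ∈ grading 𝒜 ℬ n)
      ?_ ?_ ?_ ?_ hx
    · rintro _ ⟨i, j, h, a, ha, b, hb, rfl⟩
      rw [diff_tmul dA dB ha]
      refine Submodule.add_mem _ ?_ (Submodule.smul_mem _ _ ?_)
      · rcases i with _ | i
        · rw [hA.map_zero a ha, zero_tmul]; exact Submodule.zero_mem _
        · obtain rfl : i + j = n := by omega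
          exact tmul_mem (hA.map_succ i a ha) hb
      · rcases j with _ | j
        · rw [hB.map_zero b hb, tmul_zero]; exact Submodule.zero_mem _
        · obtain rfl : i + j = n := by omega
          exact tmul_mem ha (hB.map_succ j b hb)
    · simp
    · intro x y _ _ h h'; rw [map_add]; exact Submodule.add_mem _ h h'
    · intro c x _ h; rw [map_smul]; exact Submodule.smul_mem _ _ h
  map_zero x hx := by
    refine Submodule.span_induction (p := fun x _ => diff 𝒜 ℬ dA dB x = 0) ?_ ?_ ?_ ?_ hx
    · rintro _ ⟨i, j, h, a, ha, b, hb, rfl⟩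
      obtain ⟨rfl, rfl⟩ : i = 0 ∧ j = 0 := by omega
      rw [diff_tmul dA dB ha, hA.map_zero a ha, hB.map_zero b hb, zero_tmul, tmul_zero, smul_zero,
        add_zero]
    · simp
    · intro x y _ _ h h'; rw [map_add, h, h', add_zero]
    · intro c x _ h; rw [map_smul, h, smul_zero]
  sq x := by
    induction x using induction with
    | zero => simp
    | add x y hx hy => simp only [map_add, hx, hy, add_zero]
    | tmul i j a ha b hb =>
      rw [diff_tmul dA dB ha, map_add, map_smul, diff_tmul dA dB ha, hB.sq, tmul_zero]
      rcases i with _ | i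
      · rw [hA.map_zero a ha]; simp [zero_tmul]
      · rw [diff_tmul dA dB (hA.map_succ i a ha), hA.sq, zero_tmul, pow_succ]
        simp
  comm θ x := by
    change diff 𝒜 ℬ dA dB (nabla 𝒜 ℬ cA cB θ x) = nabla 𝒜 ℬ cA cB θ (diff 𝒜 ℬ dA dB x)
    induction x using induction with
    | zero => simp
    | add x y hx hy => simp only [map_add, hx, hy]
    | tmul i j a ha b hb =>
      have hθ : θ ((-1) ^ i) = 0 := by simp [Derivation.leibniz_pow]
      have := (conn 𝒜 ℬ cA cB).leibniz θ ((-1) ^ i) (a ᵍ⊗ₜ[O] dB b)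
      change nabla 𝒜 ℬ cA cB θ _ = _ • nabla 𝒜 ℬ cA cB θ _ + _ at this
      rw [nabla_tmul, map_add, diff_tmul dA dB ha, diff_tmul dA dB (hcA θ i a ha),
        diff_tmul dA dB ha, map_add, this, hθ, zero_smul, add_zero, nabla_tmul, nabla_tmul, hA.comm,
        hB.comm, smul_add]
      abel

theorem diff_leibniz (hA : IsDifferential 𝒜 cA dA) (hB : IsDifferential ℬ cB dB)
    (hA' : ∀ n, ∀ a ∈ 𝒜 n, ∀ b, dA (a * b) = dA a * b + (-1 : O) ^ n • (a * dA b))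
    (hB' : ∀ n, ∀ a ∈ ℬ n, ∀ b, dB (a * b) = dB a * b + (-1 : O) ^ n • (a * dB b))
    (n : ℕ) (x : 𝒜 ᵍ⊗[O] ℬ) (hx : x ∈ grading 𝒜 ℬ n) (y : 𝒜 ᵍ⊗[O] ℬ) :
    diff 𝒜 ℬ dA dB (x * y) = diff 𝒜 ℬ dA dB x * y + (-1 : O) ^ n • (x * diff 𝒜 ℬ dA dB y) := by
  induction hx using Submodule.span_induction with
  | zero => simp
  | add x x' _ _ h h' => simp only [add_mul, map_add, h, h', smul_add]; abel
  | smul c x _ h =>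
    rw [smul_mul_assoc, map_smul, h, map_smul, smul_mul_assoc, smul_mul_assoc, smul_add,
      smul_comm c]
  | mem x hx =>
    obtain ⟨i, j, rfl, a, ha, b, hb, rfl⟩ := hx
    induction y using induction with
    | zero => simp
    | add x x' hx hx' => simp only [mul_add, map_add, hx, hx', smul_add]; abel
    | tmul i' j' a' ha' b' hb' =>
      have e1 : dA a ᵍ⊗ₜ[O] b * a' ᵍ⊗ₜ[O] b' =
          (-1 : O) ^ (j * i') • ((dA a * a') ᵍ⊗ₜ[O] (b * b') : 𝒜 ᵍ⊗[O] ℬ) := tmul_mul _ hb ha' _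
      have e2 : a ᵍ⊗ₜ[O] dB b * a' ᵍ⊗ₜ[O] b' =
          ((-1 : O) ^ (j * i') * (-1) ^ i') • ((a * a') ᵍ⊗ₜ[O] (dB b * b') : 𝒜 ᵍ⊗[O] ℬ) := by
        rcases j with _ | j
        · simp [hB.map_zero b hb, tmul_zero]
        · rw [tmul_mul _ (hB.map_succ j b hb) ha' _]
          congr 1
          rw [add_mul, one_mul, pow_add, mul_assoc, ← pow_add, ← two_mul, pow_mul (-1) 2]
          simp
      have e3 : a ᵍ⊗ₜ[O] b * dA a' ᵍ⊗ₜ[O] b' =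
          ((-1 : O) ^ (j * i') * (-1) ^ j) • ((a * dA a') ᵍ⊗ₜ[O] (b * b') : 𝒜 ᵍ⊗[O] ℬ) := by
        rcases i' with _ | i'
        · simp [hA.map_zero a' ha', zero_tmul]
        · rw [tmul_mul _ hb (hA.map_succ i' a' ha') _]
          congr 1
          rw [mul_add, mul_one, pow_add, mul_assoc, ← pow_add, ← two_mul, pow_mul (-1) 2]
          simp
      have e4 : a ᵍ⊗ₜ[O] b * a' ᵍ⊗ₜ[O] dB b' =
          (-1 : O) ^ (j * i') • ((a * a') ᵍ⊗ₜ[O] (b * dB b') : 𝒜 ᵍ⊗[O] ℬ) := tmul_mul _ hb ha' _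
      have hj : (-1 : O) ^ j * (-1 : O) ^ j = 1 := by
        rw [← pow_add, ← two_mul, pow_mul]; simp
      rw [tmul_mul a hb ha' b', map_smul, diff_tmul dA dB (SetLike.GradedMul.mul_mem ha ha'),
        diff_tmul dA dB ha, diff_tmul dA dB ha', hA' i a ha, hB' j b hb, add_mul, mul_add,
        smul_mul_assoc, mul_smul_comm, e1, e2, e3, e4]
      simp only [add_tmul, tmul_add, smul_tmul', tmul_smul, smul_add, smul_smul]
      have c1 : (-1 : O) ^ (i + j) * ((-1) ^ (j * i') * (-1) ^ j) = (-1) ^ (j * i') * (-1) ^ i := by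
        rw [pow_add]; linear_combination (-1 : O) ^ i * (-1) ^ (j * i') * hj
      rw [c1]
      have c2 : (-1 : O) ^ (j * i') * (-1) ^ (i + i') =
          (-1) ^ i * ((-1) ^ (j * i') * (-1) ^ i') := by ring
      have c3 : (-1 : O) ^ (j * i') * ((-1) ^ (i + i') * (-1) ^ j) =
          (-1) ^ (i + j) * ((-1) ^ i' * (-1) ^ (j * i')) := by ring
      rw [c2, c3]
      abel

end Diff

end Tens

/-- The tensor product over `O` of graded `𝒟`-algebras. -/
abbrev GDA.tensor (A B : GDA K O) : GDA K O where
  carrier := A.gr ᵍ⊗[O] B.gr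
  gr := Tens.grading A.gr B.gr
  conn := Tens.conn A.gr B.gr A.conn B.conn
  conn_mem := Tens.nabla_mem A.conn B.conn A.conn_mem B.conn_mem
  conn_mul := Tens.nabla_mul A.conn B.conn A.conn_mem B.conn_mem A.conn_mul B.conn_mul
  mul_comm m n := Tens.mul_comm' m n A.mul_comm B.mul_comm

/-- The element `a ⊗ b` of `A ⊗_O B`. -/
abbrev GDA.tmul (A B : GDA K O) (a : A.carrier) (b : B.carrier) : (A.tensor B).carrier :=
  (a ᵍ⊗ₜ[O] b : A.gr ᵍ⊗[O] B.gr)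

/-- The differential `d_A ⊗ id + id ⊗ d_B` (with the Koszul sign) on `A ⊗_O B`. -/
abbrev GDA.Differential.tensor {A B : GDA K O} (δ : A.Differential) (δ' : B.Differential) :
    (A.tensor B).Differential where
  d := Tens.diff A.gr B.gr δ.d δ'.d
  isDifferential := Tens.diff_isDifferential δ.isDifferential δ'.isDifferential A.conn_mem
  leibniz := Tens.diff_leibniz δ.isDifferential δ'.isDifferential δ.leibniz δ'.leibniz

/-- The tensor product of differential graded `𝒟`-algebras. -/
abbrev DGDA.tensor (A B : DGDA K O) : DGDA K O where
  toGDA := A.toGDA.tensor B.toGDA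
  diff := A.diff.tensor B.diff

theorem GDA.conn_one (A : GDA K O) (θ : Derivation K O O) : A.conn.nabla θ 1 = 0 := by
  have := A.conn_mul θ 1 1
  simpa using this

theorem GDA.Differential.d_one {A : GDA K O} (δ : A.Differential) : δ.d 1 = 0 :=
  δ.isDifferential.map_zero 1 SetLike.GradedOne.one_mem

/-- The morphism `A → A ⊗_O B`, `a ↦ a ⊗ 1`. -/
def DGDA.inl (A B : DGDA K O) : A ⟶ A.tensor B :=
  DGDA.Hom.mk ⟨GradedTensorProduct.includeLeft A.gr B.gr,
    fun n a ha => Submodule.subset_span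
      ⟨n, 0, add_zero n, a, ha, 1, SetLike.GradedOne.one_mem, rfl⟩,
    fun θ a => by
      change (A.conn.nabla θ a ᵍ⊗ₜ[O] (1 : B.carrier) : A.gr ᵍ⊗[O] B.gr) =
        A.conn.nabla θ a ᵍ⊗ₜ[O] (1 : B.carrier) + a ᵍ⊗ₜ[O] B.conn.nabla θ 1
      rw [GDA.conn_one, Tens.tmul_zero, add_zero]⟩
    fun a => by
      change (A.diff.d a ᵍ⊗ₜ[O] (1 : B.carrier) : A.gr ᵍ⊗[O] B.gr) =
        A.diff.d a ᵍ⊗ₜ[O] (1 : B.carrier) + signMap A.gr a ᵍ⊗ₜ[O] B.diff.d 1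
      rw [GDA.Differential.d_one, Tens.tmul_zero, add_zero]

end Tensor

/-! ### Free graded `𝒟`-modules and relative Sullivan `𝒟`-algebras -/

section Sullivan

variable (K : Type v) (O : Type u) [CommRing K] [CommRing O] [Algebra K O]

section Free

variable {J : Type u} (deg : J → ℕ)

/-- The elements of degree `n` of `⨁_{j ∈ J} 𝒟 · v_j`, where `v_j` has degree `deg j`. -/
def freeGr (n : ℕ) : Submodule O (J →₀ DiffOp K O) :=
  Finsupp.supported (DiffOp K O) O {j | deg j = n}

variable {K O deg} in
theorem single_mem_freeGr (j : J) (P : DiffOp K O) :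
    Finsupp.single j P ∈ freeGr K O deg (deg j) :=
  Finsupp.single_mem_supported O P rfl

variable {K O deg} in
theorem freeGr_induction {n : ℕ} {p : (J →₀ DiffOp K O) → Prop} (zero : p 0)
    (add : ∀ x y, p x → p y → p (x + y)) (single : ∀ j P, deg j = n → p (Finsupp.single j P))
    (x : J →₀ DiffOp K O) (hx : x ∈ freeGr K O deg n) : p x := by
  rw [← Finsupp.sum_single x]
  exact Finset.sum_induction _ p add zero fun j hj => single j _ (hx hj)

/-- The decomposition map of a free graded `𝒟`-module. -/
def freeDecompose : (J →₀ DiffOp K O) →ₗ[O] ⨁ n, freeGr K O deg n :=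
  Finsupp.lsum O fun j => DirectSum.lof O ℕ (fun n => freeGr K O deg n) (deg j) ∘ₗ
    LinearMap.codRestrict _ (Finsupp.lsingle j) (fun P => single_mem_freeGr j P)

theorem freeDecompose_single (j : J) (P : DiffOp K O) :
    freeDecompose K O deg (Finsupp.single j P) =
      DirectSum.lof O ℕ (fun n => freeGr K O deg n) (deg j)
        ⟨Finsupp.single j P, single_mem_freeGr j P⟩ := by
  rw [freeDecompose, Finsupp.lsum_single]; rfl

instance : DirectSum.Decomposition (freeGr K O deg) :=
  DirectSum.Decomposition.ofLinearMap (freeGr K O deg) (freeDecompose K O deg)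
    (by
      refine Finsupp.lhom_ext fun j P => ?_
      rw [LinearMap.comp_apply, freeDecompose_single, DirectSum.coeLinearMap_lof]; rfl)
    (by
      refine DirectSum.linearMap_ext _ fun n => LinearMap.ext ?_
      rintro ⟨x, hx⟩
      rw [LinearMap.comp_apply, LinearMap.comp_apply, DirectSum.coeLinearMap_lof]
      change freeDecompose K O deg x = DirectSum.lof O ℕ (fun n => freeGr K O deg n) n ⟨x, hx⟩
      obtain ⟨_, h⟩ := freeGr_induction (p := fun x => ∃ h : x ∈ freeGr K O deg n,
        freeDecompose K O deg x = DirectSum.lof O ℕ (fun n => freeGr K O deg n) n ⟨x, h⟩)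
        ⟨Submodule.zero_mem _, by rw [map_zero]; exact (map_zero _).symm⟩
        (by
          rintro x y ⟨hx, h⟩ ⟨hy, h'⟩
          exact ⟨Submodule.add_mem _ hx hy, by rw [map_add, h, h', ← map_add]; rfl⟩)
        (by
          rintro j P rfl
          exact ⟨single_mem_freeGr j P, freeDecompose_single K O deg j P⟩) x hx
      exact h)

/-- The flat connection of `⨁_{j ∈ J} 𝒟 · v_j`: vector fields act by left composition. -/
def freeConn : FlatConnection K O (J →₀ DiffOp K O) where
  nabla θ := Finsupp.mapRange.addMonoidHom (AddMonoidHom.mulLeft (DiffOp.ofField K θ))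
  add θ θ' x := by
    ext1 j; simp [DiffOp.ofField_add, add_mul]
  smul f θ x := by
    ext1 j; simp [DiffOp.ofField_smul, DiffOp.smul_def, mul_assoc]
  leibniz θ f x := by
    ext1 j; simp [DiffOp.smul_def, ← mul_assoc, DiffOp.ofField_mul_ofFun, add_mul]
  bracket θ θ' x := by
    ext1 j; simp [DiffOp.ofField_bracket, mul_assoc, sub_mul]

theorem freeConn_single (θ : Derivation K O O) (j : J) (P : DiffOp K O) :
    (freeConn K O).nabla θ (Finsupp.single j P) = Finsupp.single j (DiffOp.ofField K θ * P) := by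
  simp [freeConn]

variable (J) in
/-- The free non-negatively graded `𝒟`-module `⨁_{j ∈ J} 𝒟 · v_j` on a homogeneous basis
`(v_j)`, `deg v_j = deg j`. -/
abbrev freeGDM : GDM K O where
  carrier := J →₀ DiffOp K O
  gr := freeGr K O deg
  conn := freeConn K O
  conn_mem θ n m hm := by
    refine freeGr_induction (p := fun m => (freeConn K O).nabla θ m ∈ freeGr K O deg n)
      (by simp) (fun x y h h' => by rw [map_add]; exact Submodule.add_mem _ h h') ?_ m hm
    rintro j P rfl
    rw [freeConn_single]
    exact single_mem_freeGr j _

end Free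

variable {K O}

/-- The submodule `A ⊗ 𝒮(V_{<α})` of `A ⊗ 𝒮(V)`, where `V = ⨁_{j ∈ J} 𝒟 · v_j` and
`V_{<α} = ⨁_{β < α} 𝒟 · v_β`. -/
def lowerPart (A : GDA K O) {J : Type u} [LT J] (deg : J → ℕ) (α : J) :
    Submodule O (A.tensor (freeGDM K O J deg).sym).carrier :=
  Submodule.span O {x | ∃ a : A.carrier,
    ∃ s ∈ Algebra.adjoin O {y : GSym (freeGr K O deg) |
      ∃ β < α, ∃ P : DiffOp K O, y = GSym.ι _ (Finsupp.single β P)},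
    x = GDA.tmul A (freeGDM K O J deg).sym a s}

/-- The structure of a relative Sullivan `𝒟`-algebra on a morphism `i : A → C` of `DG𝒟A`: an
isomorphism of graded `𝒟`-algebras `e : A ⊗ 𝒮(V) ≅ C` that identifies `i` with `a ↦ a ⊗ 1`, where
`V` is a free graded `𝒟`-module with a homogeneous basis `(v_α)` indexed by a well-ordered set `J`,
such that the differential of `C` is lowering: `d v_α ∈ A ⊗ 𝒮(V_{<α})`. -/
structure RelSullivan {A C : DGDA K O} (i : A ⟶ C) where
  J : Type u
  [linearOrder : LinearOrder J]
  [wellFoundedLT : WellFoundedLT J]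
  deg : J → ℕ
  e : GDA.Hom (A.toGDA.tensor (freeGDM K O J deg).sym) C.toGDA
  bijective : Function.Bijective e.toAlgHom
  e_inl : ∀ a : A.carrier, e.toAlgHom (GDA.tmul A.toGDA (freeGDM K O J deg).sym a 1) = i.toAlgHom a
  lowering : ∀ α : J, ∃ x ∈ lowerPart A.toGDA deg α,
    C.diff.d (e.toAlgHom (GDA.tmul A.toGDA (freeGDM K O J deg).sym 1
      (GSym.ι _ (Finsupp.single α 1)))) = e.toAlgHom x

attribute [instance] RelSullivan.linearOrder RelSullivan.wellFoundedLT

/-- Minimality: the well-ordering is compatible with the degrees of the basis vectors. -/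
def RelSullivan.IsMinimal {A C : DGDA K O} {i : A ⟶ C} (R : RelSullivan i) : Prop :=
  ∀ α β : R.J, α ≤ β → R.deg α ≤ R.deg β

/-- Splitness: the differential is `d_A ⊗ id + id ⊗ d_𝒮` for a differential `d_𝒮` on `𝒮(V)`. -/
def RelSullivan.IsSplit {A C : DGDA K O} {i : A ⟶ C} (R : RelSullivan i) : Prop :=
  ∃ δ : (freeGDM K O R.J R.deg).sym.Differential,
    ∀ x, R.e.toAlgHom ((A.diff.tensor δ).d x) = C.diff.d (R.e.toAlgHom x)

variable (K O) in
/-- The class of split minimal relative Sullivan `𝒟`-algebras. -/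
def splitMinimalSullivan : MorphismProperty (DGDA K O) :=
  fun _ _ i => ∃ R : RelSullivan i, R.IsMinimal ∧ R.IsSplit

/-! ### The direct sum of discs `P(B)` -/

/-- The generators of `P(B) = ⨁_{n > 0} ⨁_{b ∈ Bₙ} Dⁿ`: for every `n` and every `b ∈ B_{n+1}`, the
generator `𝕀_b` of degree `n + 1` and the generator `s⁻¹𝕀_b` of degree `n` of the `(n+1)`-disc. -/
inductive DiscGen (B : GDA K O) : Type u
  | top (n : ℕ) (b : B.gr (n + 1)) : DiscGen B
  | bot (n : ℕ) (b : B.gr (n + 1)) : DiscGen B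

/-- The degree of a generator of `P(B)`. -/
def DiscGen.deg {B : GDA K O} : DiscGen B → ℕ
  | .top n _ => n + 1
  | .bot n _ => n

/-- The `𝒟`-linear differential `𝕀_b ↦ s⁻¹𝕀_b ↦ 0` of `P(B)`. -/
def discD (B : GDA K O) : (DiscGen B →₀ DiffOp K O) →ₗ[O] (DiscGen B →₀ DiffOp K O) :=
  Finsupp.lsum O fun g => match g with
    | .top n b => Finsupp.lsingle (.bot n b)
    | .bot _ _ => 0

theorem discD_top (B : GDA K O) (n : ℕ) (b : B.gr (n + 1)) (P : DiffOp K O) :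
    discD B (Finsupp.single (.top n b) P) = Finsupp.single (.bot n b) P := by
  rw [discD, Finsupp.lsum_single]; rfl

theorem discD_bot (B : GDA K O) (n : ℕ) (b : B.gr (n + 1)) (P : DiffOp K O) :
    discD B (Finsupp.single (.bot n b) P) = 0 := by
  rw [discD, Finsupp.lsum_single]; rfl

/-- The direct sum of discs `P(B)`, a differential graded `𝒟`-module. -/
abbrev discs (B : GDA K O) : DGDM K O where
  toGDM := freeGDM K O (DiscGen B) DiscGen.deg
  diff :=
    { d := discD B
      isDifferential :=
        { map_succ := fun n m hm => by
            refine freeGr_induction (p := fun m => discD B m ∈ freeGr K O DiscGen.deg n)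
              (by simp) (fun x y h h' => by rw [map_add]; exact Submodule.add_mem _ h h') ?_ m hm
            rintro (⟨k, b⟩ | ⟨k, b⟩) P h
            · rw [discD_top]
              obtain rfl : k = n := Nat.succ_injective h
              exact single_mem_freeGr (deg := DiscGen.deg) (.bot k b) P
            · rw [discD_bot]; exact Submodule.zero_mem _
          map_zero := fun m hm => by
            refine freeGr_induction (p := fun m => discD B m = 0)
              (by simp) (fun x y h h' => by rw [map_add, h, h', add_zero]) ?_ m hm
            rintro (⟨k, b⟩ | ⟨k, b⟩) P h
            · exact absurd h (Nat.succ_ne_zero k)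
            · exact discD_bot B k b P
          sq := fun m => by
            induction m using Finsupp.induction_linear with
            | zero => simp
            | add x y h h' => rw [map_add, map_add, h, h', add_zero]
            | single g P => rcases g with ⟨k, b⟩ | ⟨k, b⟩ <;> simp [discD_top, discD_bot]
          comm := fun θ m => by
            induction m using Finsupp.induction_linear with
            | zero => simp
            | add x y h h' => simp only [map_add, h, h']
            | single g P =>
              rcases g with ⟨k, b⟩ | ⟨k, b⟩
              · rw [freeConn_single, discD_top, discD_top, freeConn_single]
              · rw [freeConn_single, discD_bot, discD_bot, map_zero] } }

end Sullivan

end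

end DAlg

/-! The middle object is `A ⊗ 𝒮(P(B))` with its tensor differential. The projection `p` extends `φ`
by `𝕀_b ↦ b`, `s⁻¹𝕀_b ↦ d b`. It is a fibration because every `b` of positive degree is the image of
its own generator. Three points need an argument.

To define `p` on `P(B)`, an operator `P ∈ 𝒟` must act on `b`, although `B` only carries a flat
connection and `𝒟` is a ring of operators on `O`, not one given by generators and relations. The
question is whether an expression in functions and vector fields that kills `O` kills every module
with flat connection. Expressions are therefore treated as pairs, recording their effect on `O` and
on the module, and filtered by order. Smoothness makes the Kähler differentials finitely generated
projective, hence gives functions `xᵢ` and fields `∂ᵢ` with `θ = ∑ θ(xᵢ) ∂ᵢ` (`exists_dual_basis`).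
Commutators with functions lower the order, and Euler's formula (`HasOrder.euler`) says that `(n +
1) w` equals `∑ [w, xᵢ] ∂ᵢ` up to order `n`. If `w` vanishes on `O`, so do all `[w, xᵢ]`; these are
zero by induction on the order, then `(n + 1) w` has order at most `n` and is zero too, and
characteristic zero removes the factor (`HasOrder.eq_zero`). This yields the action
`FlatConnection.act` and the freeness of `⨁ 𝒟 · v_j` with respect to flat connections.

To see that `A → A ⊗ 𝒮(P(B))` is a weak equivalence, note that `P(B)` is contracted by `h : s⁻¹𝕀_b ↦
𝕀_b`. Extended to `𝒮(P(B))` as odd derivations, `d` and `h` have as graded commutator the even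
derivation that is the identity on generators, that is, multiplication by word length
(`GSym.symD_symH`). Dividing by the length, again in characteristic zero, gives a homotopy between
the identity and the augmentation (`GSym.symD_homotopy`), which is then tensored with `A`
(`diff_tensorHomotopy`). The homotopy is only `O`-linear, which suffices for homology.

The Sullivan conditions hold when the generators are ordered by degree, ties being broken by an
arbitrary well-ordering: `d 𝕀_b = s⁻¹𝕀_b` has smaller degree. Functoriality comes from sending the
generators indexed by `b` to those indexed by `g(b)`; all identities follow because a morphism out
of `A ⊗ 𝒮(V)`, with `V` free, is determined on `A` and on the basis (`tensor_free_hom_ext`). -/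

namespace DAlg

noncomputable section

/-! ### Modules with flat connection over smooth algebras are `𝒟`-modules -/

section Action

variable {K : Type v} {O : Type u}

/-- On a smooth algebra there are functions `xᵢ` and vector fields `∂ᵢ`, finite in number, such that
`θ = ∑ θ(xᵢ) ∂ᵢ` for every vector field `θ`. -/
theorem exists_dual_basis (K : Type v) (O : Type u) [CommRing K] [CommRing O] [Algebra K O]
    [Algebra.Smooth K O] :
    ∃ (s : Finset O) (D : O → Derivation K O O),
      ∀ θ : Derivation K O O, θ = ∑ x ∈ s, θ x • D x := by
  classical
  -- The exact differentials span the finitely generated module of Kähler differentials, so finitely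
  -- many of them already do. Choosing generators of the form `dg` is what produces the functions
  -- `xᵢ`.
  obtain ⟨s, hs, hspan⟩ := (Submodule.fg_span_iff_fg_span_finset_subset
    (Set.range (KaehlerDifferential.D K O))).1 (by
      rw [KaehlerDifferential.span_range_derivation]; exact Module.Finite.fg_top)
  rw [KaehlerDifferential.span_range_derivation] at hspan
  have hsurj : Function.Surjective (Finsupp.linearCombination O (fun y : s => (y : Ω[O⁄K]))) := by
    rw [← LinearMap.range_eq_top, Finsupp.range_linearCombination, Subtype.range_coe_subtype]
    exact hspan.symm
  -- Projectivity splits the presentation; the coordinates of the section `σ`, composed with the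
  -- universal derivation, are the fields `∂ᵢ`.
  obtain ⟨σ, hσ⟩ := Module.projective_lifting_property _ LinearMap.id hsurj
  choose g hg using fun y : s => hs y.2
  let D' : s → Derivation K O O := fun y =>
    (Finsupp.lapply y ∘ₗ σ).compDer (KaehlerDifferential.D K O)
  have key : ∀ θ : Derivation K O O, θ = ∑ y : s, θ (g y) • D' y := by
    intro θ
    ext f
    -- The section expands `df` in the generators `dg`; applying the linear extension of `θ` turns
    -- this expansion into the required formula.
    have h1 : KaehlerDifferential.D K O f =
        ∑ y : s, σ (KaehlerDifferential.D K O f) y • (y : Ω[O⁄K]) := by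
      conv_lhs => rw [← LinearMap.id_apply (R := O) (KaehlerDifferential.D K O f), ← hσ]
      rw [LinearMap.comp_apply, Finsupp.linearCombination_apply]
      exact Finsupp.sum_fintype _ _ fun _ => zero_smul _ _
    have h2 := congrArg θ.liftKaehlerDifferential h1
    rw [map_sum, Derivation.liftKaehlerDifferential_comp_D] at h2
    rw [h2, ← Derivation.coeFnAddMonoidHom_apply (∑ y : s, _), map_sum, Finset.sum_apply]
    refine Finset.sum_congr rfl fun y _ => ?_
    rw [map_smul, ← hg y, Derivation.liftKaehlerDifferential_comp_D]
    exact _root_.mul_comm _ _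
  have ginj : Function.Injective g := fun y z h => Subtype.ext (by rw [← hg y, ← hg z, h])
  -- The family is reindexed by functions instead of differentials, which loses nothing since `g` is
  -- injective. The value `0` outside the image of `g` never enters the sum.
  refine ⟨Finset.univ.image g, fun x => if h : ∃ y, g y = x then D' h.choose else 0, fun θ => ?_⟩
  rw [Finset.sum_image fun _ _ _ _ h => ginj h]
  conv_lhs => rw [key θ]
  refine Finset.sum_congr rfl fun y _ => ?_
  have h : ∃ z, g z = g y := ⟨y, rfl⟩
  beta_reduce
  rw [dif_pos h, ginj h.choose_spec]

/-- The integer `n + 1` is invertible in `K`, hence in `O`. This is where characteristic zero enters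
the construction of the action. -/
theorem eq_zero_of_succ_nsmul (K : Type v) {O : Type u} [Field K]
    [CharZero K] [CommRing O] [Algebra K O] {N : Type*} [AddCommGroup N] [Module O N] {n : ℕ} {x : N} (h : (n + 1) • x = 0) : x = 0 := by
  have h1 : algebraMap K O ((n + 1 : ℕ) : K)⁻¹ * ((n + 1 : ℕ) : O) = 1 := by
    rw [← map_natCast (algebraMap K O), ← map_mul, inv_mul_cancel₀ (Nat.cast_ne_zero.2 n.succ_ne_zero),
      map_one]
  rw [← one_smul O x, ← h1, mul_smul, Nat.cast_smul_eq_nsmul, h, smul_zero]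

/-! ### The order filtration on expressions in functions and vector fields. -/

namespace FlatConnection

variable [CommRing K] [CommRing O] [Algebra K O]
variable {M : Type u} [AddCommGroup M] [Module O M] (conn : FlatConnection K O M)

variable (K O M) in
/-- Pairs of an operator on the functions and an operator on the module `M`. -/
abbrev PairOp : Type u := Module.End K O × AddMonoid.End M

variable (K O M) in
/-- A function as a pair of multiplication operators. -/
def pairFun : O →+* PairOp K O M :=
  RingHom.prod (Algebra.lmul K O).toRingHom (Module.toAddMonoidEnd O M)

/-- A vector field as the pair of its actions on functions and on `M`. -/
def pairField (θ : Derivation K O O) : PairOp K O M := ((θ : O →ₗ[K] O), conn.nabla θ)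

theorem pairField_smul (f : O) (θ : Derivation K O O) :
    conn.pairField (f • θ) = pairFun K O M f * conn.pairField θ :=
  Prod.ext rfl (AddMonoidHom.ext fun m => conn.smul f θ m)

theorem pairField_add (θ θ' : Derivation K O O) :
    conn.pairField (θ + θ') = conn.pairField θ + conn.pairField θ' :=
  Prod.ext rfl (AddMonoidHom.ext fun m => conn.add θ θ' m)

theorem pairField_sum (s : Finset O) (D : O → Derivation K O O) :
    conn.pairField (∑ x ∈ s, D x) = ∑ x ∈ s, conn.pairField (D x) :=
  map_sum (AddMonoidHom.mk' conn.pairField conn.pairField_add) D s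

theorem pairField_mul_pairFun (θ : Derivation K O O) (f : O) :
    conn.pairField θ * pairFun K O M f =
      pairFun K O M f * conn.pairField θ + pairFun K O M (θ f) := by
  refine Prod.ext (LinearMap.ext fun x => ?_) (AddMonoidHom.ext fun m => conn.leibniz θ f m)
  change θ (f * x) = f * θ x + θ f * x
  rw [Derivation.leibniz, smul_eq_mul, smul_eq_mul, _root_.mul_comm x]

theorem pairField_bracket (θ θ' : Derivation K O O) :
    conn.pairField ⁅θ, θ'⁆ =
      conn.pairField θ * conn.pairField θ' - conn.pairField θ' * conn.pairField θ :=
  Prod.ext (LinearMap.ext fun x => Derivation.commutator_apply (D1 := θ) (D2 := θ') x)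
    (AddMonoidHom.ext fun m => conn.bracket θ θ' m)

/-- The pairs of operators given by expressions of order at most `k` in the vector fields. -/
inductive HasOrder : ℕ → PairOp K O M → Prop
  | fn (f : O) : HasOrder 0 (pairFun K O M f)
  | up (k : ℕ) (w : PairOp K O M) : HasOrder k w → HasOrder (k + 1) w
  | add (k : ℕ) (w w' : PairOp K O M) : HasOrder k w → HasOrder k w' → HasOrder k (w + w')
  | field_mul (k : ℕ) (θ : Derivation K O O) (w : PairOp K O M) :
      HasOrder k w → HasOrder (k + 1) (conn.pairField θ * w)

namespace HasOrder

variable {conn} {k : ℕ} {w w' : PairOp K O M}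

theorem mono {n : ℕ} (hw : conn.HasOrder k w) (h : k ≤ n) : conn.HasOrder n w := by
  induction h with
  | refl => exact hw
  | step _ ih => exact .up _ _ ih

/-- The function is absorbed by the leftmost factor, because `f • θ` is again a vector field. Hence
the constructors of `HasOrder` need no multiplication by functions. -/
theorem fun_mul (hw : conn.HasOrder k w) (f : O) : conn.HasOrder k (pairFun K O M f * w) := by
  induction hw with
  | fn g => rw [← map_mul]; exact .fn _
  | up k w _ ih => exact .up _ _ ih
  | add k w w' _ _ h h' => rw [mul_add]; exact .add _ _ _ h h'
  | field_mul k θ w h _ => rw [← mul_assoc, ← pairField_smul]; exact .field_mul _ _ _ h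

theorem zero (k : ℕ) : conn.HasOrder k 0 := by
  have h := HasOrder.fn (conn := conn) 0
  rw [map_zero] at h
  exact h.mono (Nat.zero_le k)

theorem neg (hw : conn.HasOrder k w) : conn.HasOrder k (-w) := by
  have := hw.fun_mul (-1)
  rw [map_neg, map_one] at this
  exact (neg_one_mul w) ▸ this

theorem sub (hw : conn.HasOrder k w) (hw' : conn.HasOrder k w') : conn.HasOrder k (w - w') := by
  rw [sub_eq_add_neg]; exact .add _ _ _ hw hw'.neg

theorem sum {s : Finset O} {w : O → PairOp K O M} (h : ∀ x ∈ s, conn.HasOrder k (w x)) :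
    conn.HasOrder k (∑ x ∈ s, w x) :=
  Finset.sum_induction _ _ (fun _ _ h h' => .add _ _ _ h h') (zero k) h

theorem mul {n : ℕ} (hw : conn.HasOrder k w) (hw' : conn.HasOrder n w') :
    conn.HasOrder (k + n) (w * w') := by
  induction hw with
  | fn f => rw [zero_add]; exact hw'.fun_mul f
  | up k w _ ih => exact ih.mono (by omega)
  | add k w w' _ _ h h' => rw [add_mul]; exact .add _ _ _ h h'
  | field_mul k θ w _ ih =>
    rw [mul_assoc, add_right_comm]; exact .field_mul _ _ _ ih

/-- The constructors that involve vector fields or relax the bound end in positive order, so only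
functions and their sums remain. This starts the induction on the order, since a function is
determined by its action on `O`. -/
theorem eq_pairFun (hw : conn.HasOrder 0 w) : ∃ f, w = pairFun K O M f := by
  generalize h : 0 = n at hw
  induction hw with
  | fn f => exact ⟨f, rfl⟩
  | up k => omega
  | add k w w' _ _ ih ih' =>
    obtain ⟨f, rfl⟩ := ih h
    obtain ⟨g, rfl⟩ := ih' h
    exact ⟨f + g, (map_add _ _ _).symm⟩
  | field_mul k => omega

/-- The commutator with a function lowers the order. -/
theorem commutator_fun (hw : conn.HasOrder k w) (f : O) : ∀ n, k ≤ n + 1 →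
    conn.HasOrder n (w * pairFun K O M f - pairFun K O M f * w) := by
  induction hw with
  | fn g =>
    intro n _
    rw [← map_mul, ← map_mul, _root_.mul_comm, sub_self]; exact zero n
  | up k w _ ih => exact fun n h => ih n (by omega)
  | add k w w' _ _ ih ih' =>
    intro n h
    rw [add_mul, mul_add, add_sub_add_comm]
    exact .add _ _ _ (ih n h) (ih' n h)
  | field_mul k θ w hw ih =>
    intro n h
    have e : conn.pairField θ * w * pairFun K O M f - pairFun K O M f * (conn.pairField θ * w) =
        conn.pairField θ * (w * pairFun K O M f - pairFun K O M f * w) +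
          pairFun K O M (θ f) * w := by
      have := congrArg (· * w) (conn.pairField_mul_pairFun θ f)
      simp only [add_mul, mul_assoc] at this
      rw [mul_sub, this, mul_assoc]; abel
    rw [e]
    refine .add _ _ _ ?_ ((hw.fun_mul _).mono (by omega))
    -- For `n = 0` the induction hypothesis has no smaller bound to offer; but then `w` is a
    -- function and commutes with `f`, so the first summand vanishes.
    rcases n with _ | n
    · obtain rfl : k = 0 := by omega
      obtain ⟨g, rfl⟩ := hw.eq_pairFun
      rw [← map_mul, ← map_mul, _root_.mul_comm, sub_self, mul_zero]
      exact zero 0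
    · exact .field_mul _ _ _ (ih n (by omega))

/-- The commutator with a vector field does not raise the order. -/
theorem commutator_field (hw : conn.HasOrder k w) (θ : Derivation K O O) :
    conn.HasOrder k (w * conn.pairField θ - conn.pairField θ * w) := by
  induction hw with
  | fn g =>
    rw [pairField_mul_pairFun, sub_add_cancel_left]
    exact (HasOrder.fn _).neg
  | up k w _ ih => exact .up _ _ ih
  | add k w w' _ _ ih ih' =>
    rw [add_mul, mul_add, add_sub_add_comm]
    exact .add _ _ _ ih ih'
  | field_mul k θ' w hw ih =>
    have e : conn.pairField θ' * w * conn.pairField θ - conn.pairField θ * (conn.pairField θ' * w) =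
        conn.pairField θ' * (w * conn.pairField θ - conn.pairField θ * w) +
          conn.pairField ⁅θ', θ⁆ * w := by
      rw [pairField_bracket]; simp only [mul_sub, sub_mul, mul_assoc]; abel
    rw [e]
    exact .add _ _ _ (.field_mul _ _ _ ih) (.field_mul _ _ _ hw)

/-- Euler's formula: `(n + 1) w` agrees with `∑ [w, xᵢ] ∂ᵢ` up to terms of order `n`. -/
theorem euler {s : Finset O} {D : O → Derivation K O O}
    (hD : ∀ θ : Derivation K O O, θ = ∑ x ∈ s, θ x • D x) (hw : conn.HasOrder k w) :
    ∀ n, k ≤ n + 1 → conn.HasOrder n ((n + 1) • w -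
      ∑ x ∈ s, (w * pairFun K O M x - pairFun K O M x * w) * conn.pairField (D x)) := by
  induction hw with
  | fn g =>
    intro n _
    rw [Finset.sum_eq_zero fun x _ => by
      rw [← map_mul, ← map_mul, _root_.mul_comm, sub_self, zero_mul], sub_zero, ← map_nsmul]
    exact (HasOrder.fn _).mono (Nat.zero_le n)
  | up k w _ ih => exact fun n h => ih n (by omega)
  | add k w w' _ _ ih ih' =>
    intro n h
    have := HasOrder.add _ _ _ (ih n h) (ih' n h)
    rw [sub_add_sub_comm, ← nsmul_add, ← Finset.sum_add_distrib] at this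
    convert this using 4 with x
    rw [add_mul, mul_add, add_sub_add_comm, add_mul]
  | field_mul k θ w hw ih =>
    intro n h
    -- Since `[θw, x] = θ[w, x] + θ(x)w`, the sum contains an extra term `∑ θ(x) w ∂ₓ`. One of the
    -- `n + 1` copies of `θw = ∑ θ(x) ∂ₓ w` is spent against it, leaving the commutators `[w, ∂ₓ]`,
    -- which do not raise the order, and `n • w` for the induction hypothesis.
    have e : (n + 1) • (conn.pairField θ * w) - ∑ x ∈ s, (conn.pairField θ * w * pairFun K O M x -
          pairFun K O M x * (conn.pairField θ * w)) * conn.pairField (D x) =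
        conn.pairField θ * (n • w -
          ∑ x ∈ s, (w * pairFun K O M x - pairFun K O M x * w) * conn.pairField (D x)) -
        ∑ x ∈ s, pairFun K O M (θ x) * (w * conn.pairField (D x) - conn.pairField (D x) * w) := by
      have h1 : conn.pairField θ * w =
          ∑ x ∈ s, pairFun K O M (θ x) * (conn.pairField (D x) * w) := by
        conv_lhs => rw [hD θ, pairField_sum, Finset.sum_mul]
        exact Finset.sum_congr rfl fun x _ => by rw [pairField_smul, mul_assoc]
      have h2 : ∀ x ∈ s, (conn.pairField θ * w * pairFun K O M x -
          pairFun K O M x * (conn.pairField θ * w)) * conn.pairField (D x) =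
          conn.pairField θ * ((w * pairFun K O M x - pairFun K O M x * w) * conn.pairField (D x)) +
          pairFun K O M (θ x) * (w * conn.pairField (D x)) := by
        intro x _
        have := congrArg (· * (w * conn.pairField (D x))) (conn.pairField_mul_pairFun θ x)
        simp only [add_mul, mul_assoc] at this
        simp only [sub_mul, mul_sub, mul_assoc] at this ⊢
        rw [this]; abel
      rw [Finset.sum_congr rfl h2, Finset.sum_add_distrib, ← Finset.mul_sum, add_smul, one_smul]
      simp only [mul_sub, Finset.sum_sub_distrib]
      rw [← h1, mul_smul_comm]
      abel
    rw [e]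
    refine sub ?_ (sum fun x _ => ((hw.commutator_field _).fun_mul _).mono (by omega))
    rcases n with _ | n
    · obtain rfl : k = 0 := by omega
      obtain ⟨g, rfl⟩ := hw.eq_pairFun
      rw [Finset.sum_eq_zero fun x _ => by
        rw [← map_mul, ← map_mul, _root_.mul_comm, sub_self, zero_mul], zero_smul, sub_zero,
        mul_zero]
      exact zero 0
    · exact .field_mul _ _ _ (ih n (by omega))

end HasOrder

/-- Each operator in `𝒟` is written as an expression in the generators, which can then also be
evaluated on `M`. The expression is not canonical; independence of the choice is the content of
`HasOrder.eq_zero`. -/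
theorem exists_hasOrder (P : DiffOp K O) :
    ∃ k w, conn.HasOrder k w ∧ w.1 = P.1 := by
  obtain ⟨P, hP⟩ := P
  induction hP using Algebra.adjoin_induction with
  | mem x hx =>
    rcases hx with ⟨f, rfl⟩ | ⟨θ, rfl⟩
    · exact ⟨0, _, .fn f, rfl⟩
    · refine ⟨1, conn.pairField θ, ?_, rfl⟩
      simpa using HasOrder.field_mul (conn := conn) 0 θ _ (.fn 1)
  | algebraMap r =>
    refine ⟨0, _, .fn (algebraMap K O r), LinearMap.ext fun x => ?_⟩
    exact (Algebra.smul_def r x).symm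
  | add x y _ _ hx hy =>
    obtain ⟨k, w, hw, rfl⟩ := hx
    obtain ⟨n, w', hw', rfl⟩ := hy
    exact ⟨k + n, w + w', .add _ _ _ (hw.mono (by omega)) (hw'.mono (by omega)), rfl⟩
  | mul x y _ _ hx hy =>
    obtain ⟨k, w, hw, rfl⟩ := hx
    obtain ⟨n, w', hw', rfl⟩ := hy
    exact ⟨k + n, w * w', hw.mul hw', rfl⟩

end FlatConnection

/-! ### The action of `𝒟` on a module with flat connection. -/

namespace FlatConnection

variable [Field K] [CharZero K] [CommRing O] [Algebra K O]
variable {M : Type u} [AddCommGroup M] [Module O M] (conn : FlatConnection K O M)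

variable {conn} in
/-- On a smooth variety, an expression in functions and vector fields that acts as zero on functions
acts as zero on every module with flat connection. -/
theorem HasOrder.eq_zero [Algebra.Smooth K O] {k : ℕ} : ∀ {w : PairOp K O M},
    conn.HasOrder k w → w.1 = 0 → w = 0 := by
  obtain ⟨s, D, hD⟩ := exists_dual_basis K O
  induction k with
  | zero =>
    intro w hw h
    obtain ⟨f, rfl⟩ := hw.eq_pairFun
    -- Evaluating the multiplication operator at `1` recovers the function.
    have : f = 0 := (mul_one f).symm.trans (LinearMap.congr_fun h (1 : O))
    rw [this, map_zero]
  | succ n ih =>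
    intro w hw h
    -- The commutators still vanish on `O` and have order at most `n`, so the induction hypothesis
    -- removes every term of the Euler sum.
    have h0 : ∀ x ∈ s,
        (w * pairFun K O M x - pairFun K O M x * w) * conn.pairField (D x) = 0 := by
      intro x _
      rw [ih (hw.commutator_fun x n le_rfl) (by simp [h]), zero_mul]
    have h1 := hw.euler hD n le_rfl
    rw [Finset.sum_eq_zero h0, sub_zero] at h1
    have h2 := ih h1 (by simp [h])
    refine Prod.ext h (AddMonoidHom.ext fun m => ?_)
    exact eq_zero_of_succ_nsmul (O := O) K (DFunLike.congr_fun (congrArg Prod.snd h2) m)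

variable [Algebra.Smooth K O]

/-- The difference of the two expressions, in the larger of the two orders, vanishes on `O`. This
makes the action well defined. -/
theorem hasOrder_ext {k n : ℕ} {w w' : PairOp K O M} (hw : conn.HasOrder k w)
    (hw' : conn.HasOrder n w') (h : w.1 = w'.1) : w = w' :=
  sub_eq_zero.1 (((hw.mono (le_max_left k n)).sub (hw'.mono (le_max_right k n))).eq_zero
    (sub_eq_zero.2 h))

/-- The pair of operators given by a differential operator. -/
def pairOf (P : DiffOp K O) : PairOp K O M := (conn.exists_hasOrder P).choose_spec.choose

/-- The chosen expression may be replaced by any convenient one; the ring axioms for the action then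
follow by adding or multiplying expressions. -/
theorem pairOf_eq {P : DiffOp K O} {k : ℕ} {w : PairOp K O M} (hw : conn.HasOrder k w)
    (h : w.1 = P.1) : conn.pairOf P = w :=
  have hP := (conn.exists_hasOrder P).choose_spec.choose_spec
  conn.hasOrder_ext hP.1 hw (hP.2.trans h.symm)

/-- The action of the differential operators on a module with flat connection. -/
def act : DiffOp K O →+* AddMonoid.End M where
  toFun P := (conn.pairOf P).2
  map_one' := by
    have := HasOrder.fn (conn := conn) 1
    rw [map_one] at this
    rw [conn.pairOf_eq this rfl]; rfl
  map_zero' := by rw [conn.pairOf_eq (.zero 0) rfl]; rfl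
  map_add' P Q := by
    obtain ⟨k, w, hw, h⟩ := conn.exists_hasOrder P
    obtain ⟨n, w', hw', h'⟩ := conn.exists_hasOrder Q
    rw [conn.pairOf_eq hw h, conn.pairOf_eq hw' h', conn.pairOf_eq
      (.add _ _ _ (hw.mono (le_max_left k n)) (hw'.mono (le_max_right k n)))
      ((congrArg₂ (· + ·) h h' : _))]
    rfl
  map_mul' P Q := by
    obtain ⟨k, w, hw, h⟩ := conn.exists_hasOrder P
    obtain ⟨n, w', hw', h'⟩ := conn.exists_hasOrder Q
    rw [conn.pairOf_eq hw h, conn.pairOf_eq hw' h', conn.pairOf_eq (hw.mul hw')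
      ((congrArg₂ (· * ·) h h' : _))]
    rfl

theorem act_ofFun (f : O) (m : M) : conn.act (DiffOp.ofFun K O f) m = f • m := by
  change (conn.pairOf _).2 m = _
  rw [conn.pairOf_eq (.fn f) rfl]; rfl

theorem act_ofField (θ : Derivation K O O) (m : M) :
    conn.act (DiffOp.ofField K θ) m = conn.nabla θ m := by
  have h : conn.HasOrder 1 (conn.pairField θ) := by
    simpa using HasOrder.field_mul (conn := conn) 0 θ _ (.fn 1)
  change (conn.pairOf _).2 m = _
  rw [conn.pairOf_eq h rfl]; rfl

theorem act_add (P Q : DiffOp K O) (m : M) : conn.act (P + Q) m = conn.act P m + conn.act Q m := by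
  rw [map_add]; rfl

theorem act_mul (P Q : DiffOp K O) (m : M) : conn.act (P * Q) m = conn.act P (conn.act Q m) := by
  rw [map_mul]; rfl

theorem act_smul (f : O) (P : DiffOp K O) (m : M) : conn.act (f • P) m = f • conn.act P m := by
  rw [DiffOp.smul_def, act_mul, act_ofFun]

end FlatConnection

section

variable [CommRing K] [CommRing O] [Algebra K O]

/-- The scalars of `K` need no case of their own, since they act as multiplication by constant
functions. -/
theorem DiffOp.induction {p : DiffOp K O → Prop} (hf : ∀ f, p (DiffOp.ofFun K O f))
    (hθ : ∀ θ, p (DiffOp.ofField K θ)) (hadd : ∀ P Q, p P → p Q → p (P + Q))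
    (hmul : ∀ P Q, p P → p Q → p (P * Q)) (P : DiffOp K O) : p P := by
  obtain ⟨P, hP⟩ := P
  induction hP using Algebra.adjoin_induction with
  | mem x hx =>
    rcases hx with ⟨f, rfl⟩ | ⟨θ, rfl⟩
    · exact hf f
    · exact hθ θ
  | algebraMap r =>
    have h : (⟨algebraMap K (Module.End K O) r, Subalgebra.algebraMap_mem _ r⟩ : DiffOp K O) =
        DiffOp.ofFun K O (algebraMap K O r) :=
      Subtype.ext (LinearMap.ext fun x => Algebra.smul_def (A := O) r x)
    exact h ▸ hf _
  | add x y hx hy h h' => exact hadd _ _ h h'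
  | mul x y hx hy h h' => exact hmul _ _ h h'

end

/-! ### `𝒟`-linear maps and free `𝒟`-modules. -/

namespace FlatConnection

variable [Field K] [CharZero K] [CommRing O] [Algebra K O] [Algebra.Smooth K O]
variable {M : Type u} [AddCommGroup M] [Module O M] (conn : FlatConnection K O M)

/-- Functions and vector fields generate `𝒟`, so an `O`-linear map that commutes with the
connections commutes with the whole action. It applies to differentials as well as to morphisms. -/
theorem map_act {N : Type u} [AddCommGroup N] [Module O N] (conn' : FlatConnection K O N)
    (f : M →ₗ[O] N) (hf : ∀ θ m, f (conn.nabla θ m) = conn'.nabla θ (f m)) (P : DiffOp K O)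
    (m : M) : f (conn.act P m) = conn'.act P (f m) := by
  induction P using DiffOp.induction generalizing m with
  | hf g => rw [act_ofFun, act_ofFun, map_smul]
  | hθ θ => rw [act_ofField, act_ofField, hf]
  | hadd P Q h h' =>
    rw [act_add, act_add, map_add, h, h']
  | hmul P Q h h' => 
    rw [act_mul, act_mul, h, h']

theorem act_mem (N : Submodule O M) (hN : ∀ θ, ∀ m ∈ N, conn.nabla θ m ∈ N) (P : DiffOp K O)
    (m : M) (hm : m ∈ N) : conn.act P m ∈ N := by
  induction P using DiffOp.induction generalizing m with
  | hf g => rw [act_ofFun]; exact N.smul_mem _ hm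
  | hθ θ => rw [act_ofField]; exact hN θ m hm
  | hadd P Q h h' => rw [act_add]; exact N.add_mem (h m hm) (h' m hm)
  | hmul P Q h h' => rw [act_mul]; exact h _ (h' m hm)

/-- The `𝒟`-linear map from a free `𝒟`-module that sends the basis vectors `v_j` to `b j`. -/
def freeLift {J : Type u} (b : J → M) : (J →₀ DiffOp K O) →ₗ[O] M :=
  Finsupp.lsum O fun j =>
    { toFun := fun P => conn.act P (b j)
      map_add' := fun P Q => by rw [map_add]; rfl
      map_smul' := fun f P => conn.act_smul f P (b j) }

theorem freeLift_single {J : Type u} (b : J → M) (j : J) (P : DiffOp K O) :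
    conn.freeLift b (Finsupp.single j P) = conn.act P (b j) := by
  rw [freeLift, Finsupp.lsum_single]; rfl

theorem freeLift_nabla {J : Type u} (b : J → M) (θ : Derivation K O O) (x : J →₀ DiffOp K O) :
    conn.freeLift b ((freeConn K O).nabla θ x) = conn.nabla θ (conn.freeLift b x) := by
  induction x using Finsupp.induction_linear with
  | zero => simp
  | add x y h h' => simp only [map_add, h, h']
  | single j P =>
    rw [freeConn_single, freeLift_single, freeLift_single, act_mul, act_ofField]

theorem freeLift_mem {J : Type u} (b : J → M) (deg : J → ℕ) (gr : ℕ → Submodule O M)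
    (hgr : ∀ θ n, ∀ m ∈ gr n, conn.nabla θ m ∈ gr n) (hb : ∀ j, b j ∈ gr (deg j)) (n : ℕ)
    (x : J →₀ DiffOp K O) (hx : x ∈ freeGr K O deg n) : conn.freeLift b x ∈ gr n := by
  refine freeGr_induction (p := fun x => conn.freeLift b x ∈ gr n) (by simp)
    (fun x y h h' => by rw [map_add]; exact Submodule.add_mem _ h h') ?_ x hx
  rintro j P rfl
  rw [freeLift_single]
  exact conn.act_mem _ (fun θ m hm => hgr θ _ m hm) P _ (hb j)

end FlatConnection

end Action

/-! ### Universal properties -/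

section Universal

variable {K : Type v} {O : Type u} [CommRing K] [CommRing O] [Algebra K O]

/-- The algebra morphism from `𝒮(M)` that extends a degree-preserving map on `M`. -/
def symAlgHom {M : GDM K O} {C : GDA K O} (f : M.carrier →ₗ[O] C.carrier)
    (hf : ∀ n, ∀ m ∈ M.gr n, f m ∈ C.gr n) : GSym M.gr →ₐ[O] C.carrier :=
  GSym.lift f fun m n a ha b hb => C.mul_comm m n _ (hf m a ha) _ (hf n b hb)

theorem symAlgHom_ι {M : GDM K O} {C : GDA K O} (f : M.carrier →ₗ[O] C.carrier) (hf)
    (m : M.carrier) : symAlgHom (C := C) f hf (GSym.ι M.gr m) = f m :=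
  GSym.lift_ι _ _ m

/-- The morphism of graded `𝒟`-algebras from `𝒮(M)` that extends a morphism of graded
`𝒟`-modules. -/
def symLift {M : GDM K O} {C : GDA K O} (f : M.carrier →ₗ[O] C.carrier)
    (hf : ∀ n, ∀ m ∈ M.gr n, f m ∈ C.gr n)
    (hc : ∀ θ m, f (M.conn.nabla θ m) = C.conn.nabla θ (f m)) : GDA.Hom M.sym C where
  toAlgHom := symAlgHom f hf
  map_mem n x hx := by
    induction hx using Submodule.span_induction with
    | zero => rw [map_zero]; exact Submodule.zero_mem _
    | add x y _ _ h h' => rw [map_add]; exact Submodule.add_mem _ h h'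
    | smul c x _ h => rw [map_smul]; exact Submodule.smul_mem _ _ h
    | mem x hx =>
      induction hx with
      | one => rw [map_one]; exact SetLike.GradedOne.one_mem
      | mul k n m x hm _ ih =>
        rw [map_mul, symAlgHom_ι]
        exact SetLike.GradedMul.mul_mem (hf k m hm) ih
  map_conn θ x := by
    change symAlgHom f hf (GSym.nabla M.conn_mem θ x) = C.conn.nabla θ (symAlgHom f hf x)
    induction x using GSym.induction with
    | hO g =>
      rw [GSym.nabla_algebraMap, AlgHom.commutes, AlgHom.commutes, Algebra.algebraMap_eq_smul_one g,
        C.conn.leibniz, GDA.conn_one, smul_zero, zero_add, Algebra.algebraMap_eq_smul_one]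
    | hι n m hm => rw [GSym.nabla_ι, symAlgHom_ι, symAlgHom_ι, hc]
    | hmul x y hx hy => simp only [GSym.nabla_mul, map_mul, map_add, hx, hy, C.conn_mul]
    | hadd x y hx hy => simp only [map_add, hx, hy]

theorem symLift_ι {M : GDM K O} {C : GDA K O} (f : M.carrier →ₗ[O] C.carrier) (hf hc)
    (m : M.carrier) : (symLift (C := C) f hf hc).toAlgHom (GSym.ι M.gr m) = f m :=
  symAlgHom_ι f hf m

/-- The two sides satisfy the same signed Leibniz rule, so agreement on `M` propagates. The rule
requires a homogeneous left factor, hence the induction on monomials, one homogeneous generator at a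
time. -/
theorem symLift_d {M : GDM K O} {C : GDA K O} (f : M.carrier →ₗ[O] C.carrier) (hf hc)
    (δ : M.Differential) (δ' : C.Differential) (h : ∀ m, f (δ.d m) = δ'.d (f m)) (x : GSym M.gr) :
    (symLift (C := C) f hf hc).toAlgHom (δ.sym.d x) =
      δ'.d ((symLift (C := C) f hf hc).toAlgHom x) := by
  change symAlgHom f hf (GSym.symD δ.isDifferential x) = δ'.d (symAlgHom f hf x)
  have key : ∀ n, ∀ x ∈ GSym.grading M.gr n,
      symAlgHom f hf (GSym.symD δ.isDifferential x) = δ'.d (symAlgHom f hf x) := by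
    intro n x hx
    induction hx using Submodule.span_induction with
    | zero => simp only [map_zero]
    | add x y _ _ h h' => simp only [map_add, h, h']
    | smul c x _ h => simp only [map_smul, h]
    | mem x hx =>
      induction hx with
      | one => rw [δ.sym.d_one, map_one, map_zero, δ'.d_one]
      | mul k n m x hm _ ih =>
        rw [GSym.symD_leibniz _ k _ (GSym.ι_mem hm), map_mul (symAlgHom f hf), symAlgHom_ι,
          δ'.leibniz k _ (hf k m hm), ← ih, ← h]
        simp only [map_add, map_mul, map_smul, symAlgHom_ι, GSym.symD_ι]
  induction x using DirectSum.Decomposition.inductionOn (GSym.grading M.gr) with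
  | zero => simp only [map_zero]
  | homogeneous x => exact key _ _ x.2
  | add x y h h' => simp only [map_add, h, h']

/-- The algebra morphism `a ⊗ b ↦ f(a) g(b)`. -/
def tensorAlgHom {A B C : GDA K O} (f : GDA.Hom A C) (g : GDA.Hom B C) :
    A.gr ᵍ⊗[O] B.gr →ₐ[O] C.carrier :=
  GradedTensorProduct.lift A.gr B.gr f.toAlgHom g.toAlgHom fun i j a b => by
    rw [Tens.sign_smul (O := O), _root_.mul_comm j i]
    exact C.mul_comm i j _ (f.map_mem i _ a.2) _ (g.map_mem j _ b.2)

theorem tensorAlgHom_tmul {A B C : GDA K O} (f : GDA.Hom A C) (g : GDA.Hom B C) (a : A.carrier)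
    (b : B.carrier) : tensorAlgHom f g (a ᵍ⊗ₜ[O] b) = f.toAlgHom a * g.toAlgHom b := rfl

/-- The morphism of graded `𝒟`-algebras `a ⊗ b ↦ f(a) g(b)`. -/
def tensorLift {A B C : GDA K O} (f : GDA.Hom A C) (g : GDA.Hom B C) :
    GDA.Hom (A.tensor B) C where
  toAlgHom := tensorAlgHom f g
  map_mem n x hx := by
    induction hx using Submodule.span_induction with
    | zero => rw [map_zero]; exact Submodule.zero_mem _
    | add x y _ _ h h' => rw [map_add]; exact Submodule.add_mem _ h h'
    | smul c x _ h => rw [map_smul]; exact Submodule.smul_mem _ _ h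
    | mem x hx =>
      obtain ⟨i, j, rfl, a, ha, b, hb, rfl⟩ := hx
      rw [tensorAlgHom_tmul]
      exact SetLike.GradedMul.mul_mem (f.map_mem i a ha) (g.map_mem j b hb)
  map_conn θ x := by
    change A.gr ᵍ⊗[O] B.gr at x
    change tensorAlgHom f g (Tens.nabla A.gr B.gr A.conn B.conn θ x) =
      C.conn.nabla θ (tensorAlgHom f g x)
    induction x using Tens.induction with
    | zero => simp only [map_zero]
    | add x y h h' => simp only [map_add, h, h']
    | tmul i j a ha b hb =>
      rw [Tens.nabla_tmul, map_add]
      simp only [tensorAlgHom_tmul, C.conn_mul, f.map_conn, g.map_conn]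

theorem tensorLift_tmul {A B C : GDA K O} (f : GDA.Hom A C) (g : GDA.Hom B C) (a : A.carrier)
    (b : B.carrier) : (tensorLift f g).toAlgHom (A.tmul B a b) = f.toAlgHom a * g.toAlgHom b :=
  rfl

theorem tensorLift_d {A B C : GDA K O} (f : GDA.Hom A C) (g : GDA.Hom B C) (δ : A.Differential)
    (δ' : B.Differential) (δ'' : C.Differential)
    (hf : ∀ a, f.toAlgHom (δ.d a) = δ''.d (f.toAlgHom a))
    (hg : ∀ b, g.toAlgHom (δ'.d b) = δ''.d (g.toAlgHom b)) (x : (A.tensor B).carrier) :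
    (tensorLift f g).toAlgHom ((δ.tensor δ').d x) = δ''.d ((tensorLift f g).toAlgHom x) := by
  change A.gr ᵍ⊗[O] B.gr at x
  change tensorAlgHom f g (Tens.diff A.gr B.gr δ.d δ'.d x) = δ''.d (tensorAlgHom f g x)
  induction x using Tens.induction with
  | zero => simp only [map_zero]
  | add x y h h' => simp only [map_add, h, h']
  | tmul i j a ha b hb =>
    rw [Tens.diff_tmul δ.d δ'.d ha, map_add, map_smul, tensorAlgHom_tmul, tensorAlgHom_tmul,
      tensorAlgHom_tmul, δ''.leibniz i _ (f.map_mem i a ha), hf, hg]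

/-- Morphisms of algebras from `A ⊗ 𝒮(M)` are determined on `A` and on `M`. -/
theorem tensor_sym_algHom_ext {A : GDA K O} {M : GDM K O} {C : Type*} [Ring C] [Algebra O C]
    {f g : (A.tensor M.sym).carrier →ₐ[O] C}
    (h : ∀ a, f (A.tmul M.sym a 1) = g (A.tmul M.sym a 1))
    (h' : ∀ m, f (A.tmul M.sym 1 (GSym.ι M.gr m)) = g (A.tmul M.sym 1 (GSym.ι M.gr m))) :
    f = g := by
  refine GradedTensorProduct.algHom_ext _ _ (AlgHom.ext h) (GSym.hom_ext h')

/-- The basis element `v_j` of `V`, as an element of `A ⊗ 𝒮(V)`. -/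
abbrev gen (A : GDA K O) {J : Type u} (deg : J → ℕ) (j : J) :
    (A.tensor (freeGDM K O J deg).sym).carrier :=
  A.tmul (freeGDM K O J deg).sym 1 (GSym.ι _ (Finsupp.single j 1))

theorem gen_mem (A : GDA K O) {J : Type u} (deg : J → ℕ) (j : J) :
    gen A deg j ∈ (A.tensor (freeGDM K O J deg).sym).gr (deg j) := by
  have h : (1 : A.carrier) ∈ A.gr 0 := SetLike.GradedOne.one_mem
  simpa using Tens.tmul_mem h (GSym.ι_mem (single_mem_freeGr (K := K) (deg := deg) j 1))

end Universal

/-! ### Morphisms out of `A ⊗ 𝒮(V)` for free `V`, and out of `A ⊗ 𝒮(P(B))`. -/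

section Discs

variable {K : Type v} {O : Type u} [Field K] [CharZero K] [CommRing O] [Algebra K O]
  [Algebra.Smooth K O]

/-- The action reconstructed from the connection on a free module is the original left
multiplication. In particular `P · v_j` is the result of `P` acting on the basis vector `v_j`. -/
theorem act_freeConn {J : Type u} (j : J) (P Q : DiffOp K O) :
    (freeConn K O).act P (Finsupp.single j Q) = Finsupp.single j (P * Q) := by
  induction P using DiffOp.induction generalizing Q with
  | hf f =>
    rw [FlatConnection.act_ofFun, Finsupp.smul_single, DiffOp.smul_def]
  | hθ θ => rw [FlatConnection.act_ofField, freeConn_single]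
  | hadd P P' h h' => rw [FlatConnection.act_add, h, h', add_mul, Finsupp.single_add]
  | hmul P P' h h' => rw [FlatConnection.act_mul, h', h, mul_assoc]

/-- Morphisms of graded `𝒟`-algebras from `A ⊗ 𝒮(V)` are determined on `A` and on the basis
of `V`. -/
theorem tensor_free_hom_ext {A C : GDA K O} {J : Type u} {deg : J → ℕ}
    {f g : GDA.Hom (A.tensor (freeGDM K O J deg).sym) C}
    (h : ∀ a, f.toAlgHom (A.tmul _ a 1) = g.toAlgHom (A.tmul _ a 1))
    (h' : ∀ j, f.toAlgHom (gen A deg j) = g.toAlgHom (gen A deg j)) :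
    f.toAlgHom = g.toAlgHom := by
  refine tensor_sym_algHom_ext h fun m => ?_
  -- The map `v ↦ f(1 ⊗ v)` is compatible with the connections because `∇_θ 1 = 0`, hence is
  -- `𝒟`-linear; its values on the basis then determine it.
  have hlin : ∀ f : GDA.Hom (A.tensor (freeGDM K O J deg).sym) C, ∀ j P,
      f.toAlgHom (A.tmul _ 1 (GSym.ι _ (Finsupp.single j P))) =
        C.conn.act P (f.toAlgHom (gen A deg j)) := by
    intro f j P
    let l : (J →₀ DiffOp K O) →ₗ[O] C.carrier :=
      f.toAlgHom.toLinearMap ∘ₗ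
        (GradedTensorProduct.includeRight A.gr (freeGDM K O J deg).sym.gr).toLinearMap ∘ₗ
        GSym.ι (freeGr K O deg)
    have := (freeConn K O).map_act C.conn l (by
      intro θ m
      change f.toAlgHom (A.tmul _ 1 (GSym.ι _ _)) =
        C.conn.nabla θ (f.toAlgHom (A.tmul _ 1 (GSym.ι _ m)))
      rw [← f.map_conn]
      congr 1
      refine Eq.trans ?_ (Tens.nabla_tmul A.conn (freeGDM K O J deg).sym.conn θ 1 _).symm
      rw [GDA.conn_one, Tens.zero_tmul, zero_add]
      congr 1
      exact (GSym.nabla_ι _ θ m).symm) P (Finsupp.single j 1)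
    rw [act_freeConn, mul_one] at this
    exact this
  induction m using Finsupp.induction_linear with
  | zero => rw [map_zero, GDA.tmul, Tens.tmul_zero, map_zero, map_zero]
  | add x y hx hy => rw [map_add, GDA.tmul, Tens.tmul_add, map_add, map_add, hx, hy]
  | single j P => rw [hlin f, hlin g, h']

variable {A C : DGDA K O} {B : GDA K O}

theorem discs_hom_ext {f g : A.tensor (discs B).sym ⟶ C}
    (h : ∀ a, f.toAlgHom (A.tmul (discs B).sym.toGDA a 1) =
      g.toAlgHom (A.tmul (discs B).sym.toGDA a 1))
    (h' : ∀ j, f.toAlgHom (gen A.toGDA DiscGen.deg j) = g.toAlgHom (gen A.toGDA DiscGen.deg j)) :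
    f = g := by
  have := tensor_free_hom_ext h h'
  rcases f with ⟨⟨f, _, _⟩, _⟩
  rcases g with ⟨⟨g, _, _⟩, _⟩
  obtain rfl : f = g := this
  rfl

/-- The morphism from `A ⊗ 𝒮(P(B))` given by a morphism on `A` and the images of the generators
of `P(B)`. -/
def discsLift (f : A ⟶ C) (b : DiscGen B → C.carrier) (hb : ∀ j, b j ∈ C.gr j.deg)
    (htop : ∀ n x, C.diff.d (b (.top n x)) = b (.bot n x))
    (hbot : ∀ n x, C.diff.d (b (.bot n x)) = 0) : A.tensor (discs B).sym ⟶ C :=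
  DGDA.Hom.mk (tensorLift f.toHom (symLift (M := (discs B).toGDM) (C.conn.freeLift b)
    (C.conn.freeLift_mem b _ C.gr C.conn_mem hb) (C.conn.freeLift_nabla b)))
    (tensorLift_d _ _ A.diff (discs B).sym.diff C.diff f.map_d
      (symLift_d _ _ _ (discs B).diff C.diff fun m => by
        change C.conn.freeLift b (discD B m) = _
        induction m using Finsupp.induction_linear with
        | zero => simp only [map_zero]
        | add x y h h' => simp only [map_add, h, h']
        | single j P =>
          -- The differential of `C` is `𝒟`-linear, so it passes through the action of `P`, and only
          -- the two relations on generators have to be checked.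
          rw [FlatConnection.freeLift_single, C.conn.map_act C.conn C.diff.d
            (fun θ m => C.diff.isDifferential.comm θ m)]
          rcases j with ⟨n, x⟩ | ⟨n, x⟩
          · rw [discD_top, FlatConnection.freeLift_single, htop]
          · rw [discD_bot, map_zero, hbot, map_zero]))

variable (f : A ⟶ C) (b : DiscGen B → C.carrier) (hb : ∀ j, b j ∈ C.gr j.deg)
    (htop : ∀ n x, C.diff.d (b (.top n x)) = b (.bot n x))
    (hbot : ∀ n x, C.diff.d (b (.bot n x)) = 0)

theorem discsLift_inl (a : A.carrier) :
    (discsLift f b hb htop hbot).toAlgHom (A.tmul (discs B).sym.toGDA a 1) = f.toAlgHom a := by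
  refine (tensorLift_tmul _ _ _ _).trans ?_
  rw [map_one, mul_one]

theorem discsLift_gen (j : DiscGen B) :
    (discsLift f b hb htop hbot).toAlgHom (gen A.toGDA DiscGen.deg j) = b j := by
  refine (tensorLift_tmul _ _ _ _).trans ?_
  rw [map_one, one_mul, symLift_ι, FlatConnection.freeLift_single, map_one]
  rfl

end Discs

/-! ### Contractible modules generate acyclic extensions -/

namespace GSym

variable {K : Type v} {O : Type u} [CommRing K] [CommRing O] [Algebra K O]
variable {M : Type u} [AddCommGroup M] [Module O M] {gr : ℕ → Submodule O M}

theorem mem_pow_of_isMonomial {n : ℕ} {x : GSym gr} (hx : IsMonomial gr n x) :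
    ∃ k, x ∈ LinearMap.range (ι gr) ^ k := by
  induction hx with
  | one => exact ⟨0, by rw [pow_zero]; exact Submodule.one_le.1 le_rfl⟩
  | mul k n m x _ _ ih =>
    obtain ⟨l, hl⟩ := ih
    exact ⟨l + 1, by rw [pow_succ']; exact Submodule.mul_mem_mul ⟨m, rfl⟩ hl⟩

/-- `𝒮_O(M)` is additively generated by the elements of the powers of `M`. -/
theorem pow_induction [DirectSum.Decomposition gr] {p : GSym gr → Prop}
    (h : ∀ k, ∀ x ∈ LinearMap.range (ι gr) ^ k, p x) (hadd : ∀ x y, p x → p y → p (x + y))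
    (x : GSym gr) : p x := by
  induction x using DirectSum.Decomposition.inductionOn (grading gr) with
  | zero => exact h 0 0 (Submodule.zero_mem _)
  | add x y hx hy => exact hadd x y hx hy
  | @homogeneous n x =>
    obtain ⟨x, hx⟩ := x
    change p x
    -- The span is treated as the additive group generated by scalar multiples of monomials. Each
    -- such multiple lies in a single power of `M`, so no closure of `p` under scalars is required.
    induction hx using Submodule.closure_induction with
    | zero => exact h 0 0 (Submodule.zero_mem _)
    | add x y _ _ hx hy => exact hadd x y hx hy
    | smul_mem c x hx =>
      obtain ⟨k, hk⟩ := mem_pow_of_isMonomial hx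
      exact h k _ (Submodule.smul_mem _ c hk)

/-- The algebra morphism `m₁ ⊙ ⋯ ⊙ m_k ↦ (m₁ ⊙ ⋯ ⊙ m_k) t^k`. -/
def lengthHom : GSym gr →ₐ[O] Polynomial (GSym gr) :=
  lift
    { toFun := fun m => Polynomial.monomial 1 (ι gr m)
      map_add' := fun a b => by rw [map_add, map_add]
      map_smul' := fun c a => by rw [map_smul, RingHom.id_apply, Polynomial.smul_monomial] }
    (by
      intro m n a ha b hb
      change Polynomial.monomial 1 (ι gr a) * Polynomial.monomial 1 (ι gr b) =
        _ • (Polynomial.monomial 1 (ι gr b) * Polynomial.monomial 1 (ι gr a))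
      rw [Polynomial.monomial_mul_monomial, Polynomial.monomial_mul_monomial,
        Polynomial.smul_monomial, ι_mul_ι ha hb])

/-- The exponent of `t` records word length. Reading off polynomial coefficients therefore makes
length-dependent scaling well defined, without first splitting `𝒮(M)` into a direct sum by length.
-/
theorem lengthHom_of_mem {k : ℕ} {x : GSym gr} (hx : x ∈ LinearMap.range (ι gr) ^ k) :
    lengthHom x = Polynomial.monomial k x := by
  induction hx using Submodule.pow_induction_on_left' with
  | algebraMap r => rw [AlgHom.commutes]; rfl
  | add x y i _ _ hx hy => rw [map_add, hx, hy, map_add]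
  | mem_mul m hm i x _ hx =>
    obtain ⟨m, rfl⟩ := hm
    have h : lengthHom (ι gr m) = Polynomial.monomial 1 (ι gr m) := lift_ι _ _ m
    rw [map_mul, hx, h, Polynomial.monomial_mul_monomial, Nat.succ_eq_add_one, add_comm]

/-- The linear map that multiplies the elements of length `k` by `c k`. -/
def scaleLength (c : ℕ → O) : GSym gr →ₗ[O] GSym gr :=
  Polynomial.lsum (fun k => c k • LinearMap.id) ∘ₗ lengthHom.toLinearMap

theorem scaleLength_of_mem (c : ℕ → O) {k : ℕ} {x : GSym gr}
    (hx : x ∈ LinearMap.range (ι gr) ^ k) : scaleLength c x = c k • x := by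
  rw [scaleLength, LinearMap.comp_apply, AlgHom.toLinearMap_apply, lengthHom_of_mem hx,
    Polynomial.lsum_apply, Polynomial.sum_monomial_index _ _ (by simp)]
  rfl

/-- The augmentation `𝒮_O(M) → O`. -/
def augmentation : GSym gr →ₐ[O] O := lift 0 (by simp)

theorem augmentation_ι (m : M) : augmentation (ι gr m) = 0 := lift_ι _ _ m

theorem augmentation_of_mem {k : ℕ} {x : GSym gr} (hx : x ∈ LinearMap.range (ι gr) ^ (k + 1)) :
    augmentation x = 0 := by
  rw [pow_succ'] at hx
  induction hx using Submodule.mul_induction_on' with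
  | mem_mul_mem m hm y _ =>
    obtain ⟨m, rfl⟩ := hm
    rw [map_mul, augmentation_ι, zero_mul]
  | add x _ y _ hx hy => rw [map_add, hx, hy, add_zero]

variable [DirectSum.Decomposition gr]

theorem sign_sign (x : GSym gr) : sign gr (sign gr x) = x := by
  induction x using induction with
  | hO f => simp
  | hι n m hm =>
    rw [sign_ι gr hm, map_smul, sign_ι gr hm, smul_smul, ← pow_add, ← two_mul, pow_mul]
    simp
  | hmul x y hx hy => rw [map_mul, map_mul, hx, hy]
  | hadd x y hx hy => rw [map_add, map_add, hx, hy]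

/-! ### The derivation extending a contraction, and its commutator with `d`. -/

section Homotopy

variable {h : M →ₗ[O] M} (hh : ∀ n, ∀ m ∈ gr n, h m ∈ gr (n + 1))

/-- Auxiliary morphism `x ↦ ((±x, Hx), (0, x))`. -/
def hHom : GSym gr →ₐ[O] Matrix (Fin 2) (Fin 2) (GSym gr) :=
  lift
    -- The upper right entry of a product of such matrices is `Hx · y + (±x) · Hy`, so
    -- multiplicativity encodes the graded Leibniz rule. It remains to check that the matrices of
    -- homogeneous generators satisfy the graded commutation relation.
    { toFun := fun m => !![ι gr (signMap gr m), ι gr (h m); 0, ι gr m]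
      map_add' := fun a b => by ext i j; fin_cases i <;> fin_cases j <;> simp
      map_smul' := fun c a => by ext i j; fin_cases i <;> fin_cases j <;> simp }
    (by
      intro m n a ha b hb
      have h1 : ι gr a * ι gr (h b) =
          ((-1 : O) ^ (m * n) * (-1 : O) ^ m) • (ι gr (h b) * ι gr a) := by
        rw [ι_mul_ι ha (hh n b hb), mul_add, pow_add, mul_one]
      have h2 : ι gr (h a) * ι gr b =
          ((-1 : O) ^ (m * n) * (-1 : O) ^ n) • (ι gr b * ι gr (h a)) := by
        rw [ι_mul_ι (hh m a ha) hb, add_mul, pow_add, one_mul]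
      have h3 := ι_mul_ι ha hb
      have h4 : ι gr (signMap gr a) = (-1 : O) ^ m • ι gr a := by
        rw [signMap_of_mem ha, map_smul]
      have h5 : ι gr (signMap gr b) = (-1 : O) ^ n • ι gr b := by
        rw [signMap_of_mem hb, map_smul]
      have hm : (-1 : O) ^ m * (-1 : O) ^ m = 1 := by
        rw [← pow_add, ← two_mul, pow_mul]; simp
      ext i j
      fin_cases i <;> fin_cases j
      · simp only [LinearMap.coe_mk, AddHom.coe_mk, h4, h5, Matrix.smul_of, Matrix.smul_cons,
          Matrix.mul_fin_two]
        simp [h3, smul_smul, mul_assoc, mul_comm]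
        congr 1; ring
      · simp [h4, h5, h1, h2, smul_smul]
        rw [add_comm, mul_left_comm, hm, mul_one]
      · simp
      · simpa using h3)

theorem hHom_ι (m : M) : hHom hh (ι gr m) = !![ι gr (signMap gr m), ι gr (h m); 0, ι gr m] := by
  rw [hHom, lift_ι]; rfl

theorem hHom_apply (x : GSym gr) :
    hHom hh x 0 0 = sign gr x ∧ hHom hh x 1 0 = 0 ∧ hHom hh x 1 1 = x := by
  induction x using induction with
  | hO f => simp [Matrix.algebraMap_matrix_apply]
  | hι n m hm => simp [hHom_ι, sign, lift_ι]
  | hmul x y hx hy =>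
    simp [Matrix.mul_apply, Fin.sum_univ_two, hx, hy]
  | hadd x y hx hy => simp [hx, hy]

/-- The graded derivation of `𝒮_O(M)` that extends a map `h` of degree one on `M`. -/
def symH : GSym gr →ₗ[O] GSym gr where
  toFun x := hHom hh x 0 1
  map_add' x y := by simp
  map_smul' c x := by simp

theorem symH_ι (m : M) : symH hh (ι gr m) = ι gr (h m) := by
  change hHom hh _ 0 1 = _
  simp [hHom_ι]

theorem symH_algebraMap (f : O) : symH hh (algebraMap O _ f) = 0 := by
  change hHom hh _ 0 1 = _
  simp [Matrix.algebraMap_matrix_apply]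

theorem symH_mul (x y : GSym gr) : symH hh (x * y) = symH hh x * y + sign gr x * symH hh y := by
  change hHom hh _ 0 1 = hHom hh _ 0 1 * _ + _ * hHom hh _ 0 1
  rw [map_mul, Matrix.mul_apply, Fin.sum_univ_two, (hHom_apply hh x).1, (hHom_apply hh y).2.2,
    add_comm]

/-- The derivation has odd degree, so it anticommutes with the sign automorphism. This sign is what
cancels the mixed terms in `symD_symH_mul`. -/
theorem symH_sign (x : GSym gr) : symH hh (sign gr x) = - sign gr (symH hh x) := by
  induction x using induction with
  | hO f => simp [symH_algebraMap]
  | hι n m hm =>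
    rw [sign_ι gr hm, map_smul, symH_ι, sign_ι gr (hh n m hm), pow_succ]; simp
  | hmul x y hx hy => simp only [map_mul, symH_mul, hx, hy, map_add]; noncomm_ring
  | hadd x y hx hy => simp only [map_add, hx, hy, neg_add]

variable {conn : FlatConnection K O M} {d : M →ₗ[O] M} (hd : IsDifferential gr conn d)

/-- The differential is induced by a linear map of `M`, so it replaces one factor of a word by
another and keeps the length. Hence it is compatible with scaling by length. -/
theorem symD_mem_pow {k : ℕ} {x : GSym gr} (hx : x ∈ LinearMap.range (ι gr) ^ k) :
    symD hd x ∈ LinearMap.range (ι gr) ^ k := by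
  have hsign : ∀ m, sign gr (ι gr m) = ι gr (signMap gr m) := fun m => lift_ι _ _ m
  induction hx using Submodule.pow_induction_on_left' with
  | algebraMap r => rw [symD_algebraMap]; exact Submodule.zero_mem _
  | add x y i _ _ hx hy => rw [map_add]; exact Submodule.add_mem _ hx hy
  | mem_mul m hm i x h hx =>
    obtain ⟨m, rfl⟩ := hm
    rw [symD_mul, symD_ι, hsign, Nat.succ_eq_add_one, pow_succ']
    exact Submodule.add_mem _ (Submodule.mul_mem_mul ⟨_, rfl⟩ h)
      (Submodule.mul_mem_mul ⟨_, rfl⟩ hx)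

/-- The graded commutator of two odd derivations is an even derivation: the mixed terms occur in
pairs with opposite signs. -/
theorem symD_symH_mul (x y : GSym gr) :
    symD hd (symH hh (x * y)) + symH hh (symD hd (x * y)) =
      (symD hd (symH hh x) + symH hh (symD hd x)) * y +
        x * (symD hd (symH hh y) + symH hh (symD hd y)) := by
  simp only [symD_mul, symH_mul, map_add, symD_sign, symH_sign, sign_sign]
  noncomm_ring

/-- If `h` contracts `M`, then the graded commutator of `d` and the derivation extending `h` is
multiplication by the length. -/
theorem symD_symH (hdh : ∀ m, d (h m) + h (d m) = m) {k : ℕ} {x : GSym gr}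
    (hx : x ∈ LinearMap.range (ι gr) ^ k) : symD hd (symH hh x) + symH hh (symD hd x) = k • x := by
  induction hx using Submodule.pow_induction_on_left' with
  | algebraMap r => simp [symD_algebraMap, symH_algebraMap]
  | add x y i _ _ hx hy =>
    rw [nsmul_add, ← hx, ← hy]; simp only [map_add]; abel
  | mem_mul m hm i x _ hx =>
    obtain ⟨m, rfl⟩ := hm
    rw [symD_symH_mul, hx, symH_ι, symD_ι, symD_ι, symH_ι, ← map_add, hdh, mul_smul_comm,
      Nat.succ_eq_add_one, add_smul, one_smul, add_comm]

end Homotopy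

end GSym

namespace GSym

variable {K : Type v} {O : Type u} [Field K] [CommRing O] [Algebra K O]
variable {M : Type u} [AddCommGroup M] [Module O M] {gr : ℕ → Submodule O M}
  [DirectSum.Decomposition gr] {h : M →ₗ[O] M} (hh : ∀ n, ∀ m ∈ gr n, h m ∈ gr (n + 1))

variable (K) in
/-- The contraction of `𝒮_O(M)` onto `O` induced by a contraction of `M`. -/
def homotopy : GSym gr →ₗ[O] GSym gr :=
  symH hh ∘ₗ scaleLength fun k => algebraMap K O (k : K)⁻¹

/-- On words of length `k` the commutator is multiplication by `k`, and the scaling divides by it.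
Only length zero, the image of `O`, escapes, and the augmentation accounts for it. -/
theorem symD_homotopy [CharZero K] {conn : FlatConnection K O M} {d : M →ₗ[O] M}
    (hd : IsDifferential gr conn d) (hdh : ∀ m, d (h m) + h (d m) = m) (x : GSym gr) :
    symD hd (homotopy K hh x) + homotopy K hh (symD hd x) =
      x - algebraMap O _ (augmentation x) := by
  induction x using pow_induction with
  | hadd x y hx hy =>
    simp only [map_add]
    rw [add_add_add_comm, hx, hy, sub_add_sub_comm]
  | h k x hx =>
    have e : symD hd (homotopy K hh x) + homotopy K hh (symD hd x) =
        (algebraMap K O (k : K)⁻¹ * (k : O)) • x := by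
      rw [homotopy, LinearMap.comp_apply, LinearMap.comp_apply, scaleLength_of_mem _ hx,
        scaleLength_of_mem _ (symD_mem_pow hd hx), map_smul, map_smul, map_smul, ← smul_add,
        symD_symH hh hd hdh hx, mul_smul, Nat.cast_smul_eq_nsmul]
    rw [e]
    -- In length zero the coefficient `0⁻¹ * 0` is zero by the convention for the inverse of zero,
    -- and the right-hand side vanishes because the augmentation is the identity on `O`.
    rcases k with _ | k
    · rw [pow_zero] at hx
      obtain ⟨f, rfl⟩ := Submodule.mem_one.1 hx
      simp
    · rw [augmentation_of_mem hx, map_zero, sub_zero, ← map_natCast (algebraMap K O), ← map_mul,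
        inv_mul_cancel₀ (Nat.cast_ne_zero.2 k.succ_ne_zero), map_one, one_smul]

end GSym

/-! ### The extension `A → A ⊗ 𝒮(M)` for contractible `M`. -/

section Contraction

variable {K : Type v} {O : Type u} [Field K] [CommRing O] [Algebra K O]
variable (A : DGDA K O) (M : DGDM K O)

/-- The projection `A ⊗ 𝒮(M) → A`, `a ⊗ m ↦ 0`. -/
def symProj : A.tensor M.sym ⟶ A :=
  DGDA.Hom.mk
    (tensorLift (DGDA.Hom.toHom (𝟙 A)) (symLift (M := M.toGDM) (C := A.toGDA) 0
      (fun n m _ => Submodule.zero_mem _) (fun θ m => by simp)))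
    (tensorLift_d _ _ A.diff M.sym.diff A.diff (fun _ => rfl)
      (symLift_d _ _ _ M.diff A.diff fun m => by simp))

theorem symProj_tmul (a : A.carrier) (x : GSym M.gr) :
    (symProj A M).toAlgHom (A.tmul M.sym.toGDA a x) = GSym.augmentation x • a := by
  have h : ∀ x, symAlgHom (M := M.toGDM) (C := A.toGDA) 0 (fun n m _ => Submodule.zero_mem _) x =
      algebraMap O A.carrier (GSym.augmentation x) := by
    intro x
    refine DFunLike.congr_fun (f := symAlgHom (M := M.toGDM) (C := A.toGDA) 0
      (fun n m _ => Submodule.zero_mem _))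
      (g := (Algebra.ofId O A.carrier).comp GSym.augmentation) (GSym.hom_ext fun m => ?_) x
    rw [symAlgHom_ι, AlgHom.comp_apply, GSym.augmentation_ι, map_zero]
    rfl
  refine (tensorLift_tmul _ _ _ _).trans ?_
  exact (congrArg (a * ·) (h x)).trans ((Algebra.commutes _ a).symm.trans
    (Algebra.smul_def _ a).symm)

theorem symProj_inl (a : A.carrier) :
    (symProj A M).toAlgHom ((DGDA.inl A M.sym).toAlgHom a) = a := by
  refine (symProj_tmul A M a 1).trans ?_
  rw [map_one, one_smul]

variable {A M} {h : M.carrier →ₗ[O] M.carrier} (hh : ∀ n, ∀ m ∈ M.gr n, h m ∈ M.gr (n + 1))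

variable (A) in
/-- The homotopy `a ⊗ x ↦ (-1)^{|a|} a ⊗ K(x)` on `A ⊗ 𝒮(M)`. -/
def tensorHomotopy : A.gr ᵍ⊗[O] M.sym.gr →ₗ[O] A.gr ᵍ⊗[O] M.sym.gr :=
  (GradedTensorProduct.of O A.gr M.sym.gr).toLinearMap ∘ₗ
    TensorProduct.map (signMap A.gr) (GSym.homotopy K hh) ∘ₗ
    (GradedTensorProduct.of O A.gr M.sym.gr).symm.toLinearMap

theorem tensorHomotopy_tmul {i : ℕ} {a : A.carrier} (ha : a ∈ A.gr i) (x : GSym M.gr) :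
    tensorHomotopy A hh (a ᵍ⊗ₜ[O] x) = (-1 : O) ^ i • a ᵍ⊗ₜ[O] GSym.homotopy K hh x := by
  rw [← Tens.smul_tmul', ← signMap_of_mem ha]; rfl

/-- The sign `(-1)^{|a|}` makes the terms with `d_A a` cancel, since `d_A` changes the parity of the
degree, and squares to one in the others. What remains is `a` tensored with the homotopy identity of
`𝒮(M)`. -/
theorem diff_tensorHomotopy [CharZero K] (hdh : ∀ m, M.diff.d (h m) + h (M.diff.d m) = m)
    (x : A.gr ᵍ⊗[O] M.sym.gr) :
    (A.tensor M.sym).diff.d (tensorHomotopy A hh x) +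
        tensorHomotopy A hh ((A.tensor M.sym).diff.d x) =
      x - (DGDA.inl A M.sym).toAlgHom ((symProj A M).toAlgHom x) := by
  change Tens.diff A.gr M.sym.gr A.diff.d M.sym.diff.d (tensorHomotopy A hh x) +
        tensorHomotopy A hh (Tens.diff A.gr M.sym.gr A.diff.d M.sym.diff.d x) = _
  induction x using Tens.induction with
  | zero => simp only [map_zero, add_zero, sub_zero]
  | add x y hx hy =>
    have e : (DGDA.inl A M.sym).toAlgHom ((symProj A M).toAlgHom (x + y)) =
        (DGDA.inl A M.sym).toAlgHom ((symProj A M).toAlgHom x) +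
        (DGDA.inl A M.sym).toAlgHom ((symProj A M).toAlgHom y) :=
      (congrArg _ (map_add (symProj A M).toAlgHom x y)).trans (map_add _ _ _)
    rw [e, add_sub_add_comm, ← hx, ← hy]
    simp only [map_add]
    abel
  | tmul i j a ha x hx =>
    have hi : (-1 : O) ^ i * (-1 : O) ^ i = 1 := by
      rw [← pow_add, ← two_mul, pow_mul]; simp
    -- The factor `d a` has degree `i - 1`, whence the opposite sign; for `i = 0` both sides vanish.
    have e1 : tensorHomotopy A hh (A.diff.d a ᵍ⊗ₜ[O] x) =
        -((-1 : O) ^ i • A.diff.d a ᵍ⊗ₜ[O] GSym.homotopy K hh x) := by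
      rcases i with _ | i
      · rw [A.diff.isDifferential.map_zero a ha]
        simp only [Tens.zero_tmul, map_zero, smul_zero, neg_zero]
      · rw [tensorHomotopy_tmul hh (A.diff.isDifferential.map_succ i a ha), pow_succ]
        simp
    have e2 : (DGDA.inl A M.sym).toAlgHom ((symProj A M).toAlgHom
        (a ᵍ⊗ₜ[O] x : A.gr ᵍ⊗[O] M.sym.gr)) =
        (a ᵍ⊗ₜ[O] algebraMap O (GSym M.gr) (GSym.augmentation x) : A.gr ᵍ⊗[O] M.sym.gr) := by
      refine (congrArg _ (symProj_tmul A M a x)).trans ?_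
      rw [Algebra.algebraMap_eq_smul_one, Tens.tmul_smul]
      rfl
    rw [e2, tensorHomotopy_tmul hh ha, map_smul, Tens.diff_tmul _ _ ha, Tens.diff_tmul _ _ ha,
      map_add, map_smul, e1, tensorHomotopy_tmul hh ha, smul_add, smul_smul, smul_smul, hi,
      one_smul, one_smul]
    have := GSym.symD_homotopy hh M.diff.isDifferential hdh x
    have e3 : (a ᵍ⊗ₜ[O] M.sym.diff.d (GSym.homotopy K hh x) : A.gr ᵍ⊗[O] M.sym.gr) +
        a ᵍ⊗ₜ[O] GSym.homotopy K hh (M.sym.diff.d x) =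
        a ᵍ⊗ₜ[O] x - a ᵍ⊗ₜ[O] algebraMap O (GSym M.gr) (GSym.augmentation x) := by
      rw [← Tens.tmul_add, eq_sub_iff_add_eq, ← Tens.tmul_add]
      congr 1
      rw [← eq_sub_iff_add_eq]
      exact this
    rw [← e3]
    abel

/-- If `M` is contractible, then `A → A ⊗ 𝒮(M)` is a weak equivalence. -/
theorem weakEquivalences_inl [CharZero K] {h : M.carrier →ₗ[O] M.carrier}
    (hh : ∀ n, ∀ m ∈ M.gr n, h m ∈ M.gr (n + 1)) (hdh : ∀ m, M.diff.d (h m) + h (M.diff.d m) = m) :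
    weakEquivalences K O (DGDA.inl A M.sym) := by
  constructor
  · rw [injective_iff_map_eq_zero]
    intro z hz
    obtain ⟨⟨a, ha⟩, rfl⟩ := Submodule.Quotient.mk_surjective _ z
    obtain ⟨y, hy⟩ := (Submodule.Quotient.mk_eq_zero _).1 hz
    -- The projection is a retraction of chain complexes, so it carries a primitive in the extension
    -- to a primitive in `A`.
    refine (Submodule.Quotient.mk_eq_zero _).2 ⟨(symProj A M).toAlgHom y, ?_⟩
    rw [← (symProj A M).map_d, hy]
    exact symProj_inl A M a
  · intro z
    obtain ⟨⟨x, hx⟩, rfl⟩ := Submodule.Quotient.mk_surjective _ z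
    have hx : (A.tensor M.sym).diff.d x = 0 := hx
    refine ⟨Submodule.Quotient.mk ⟨(symProj A M).toAlgHom x, ?_⟩, ?_⟩
    · change A.diff.d _ = 0
      rw [← (symProj A M).map_d, hx, map_zero]
    -- For a cycle `x` the homotopy identity reads `d(Hx) = x - i(q x)`, where `i` is the inclusion
    -- and `q` the projection. The difference needed here is `i(q x) - x`, whence the minus sign.
    · refine ((Submodule.Quotient.eq _).2 ⟨-tensorHomotopy A hh x, ?_⟩)
      have := diff_tensorHomotopy (A := A) hh hdh x
      rw [hx, map_zero, add_zero] at this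
      rw [map_neg, this, neg_sub]
      rfl

end Contraction

/-! ### The factorization -/

section Discs

variable {K : Type v} {O : Type u} [CommRing K] [CommRing O] [Algebra K O]

/-- The contraction `s⁻¹𝕀_b ↦ 𝕀_b`, `𝕀_b ↦ 0` of `P(B)`. -/
def discH (B : GDA K O) : (DiscGen B →₀ DiffOp K O) →ₗ[O] (DiscGen B →₀ DiffOp K O) :=
  Finsupp.lsum O fun g => match g with
    | .top _ _ => 0
    | .bot n b => Finsupp.lsingle (.top n b)

theorem discH_top (B : GDA K O) (n : ℕ) (b : B.gr (n + 1)) (P : DiffOp K O) :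
    discH B (Finsupp.single (.top n b) P) = 0 := by
  rw [discH, Finsupp.lsum_single]; rfl

theorem discH_bot (B : GDA K O) (n : ℕ) (b : B.gr (n + 1)) (P : DiffOp K O) :
    discH B (Finsupp.single (.bot n b) P) = Finsupp.single (.top n b) P := by
  rw [discH, Finsupp.lsum_single]; rfl

theorem discH_mem (B : GDA K O) (n : ℕ) (m : DiscGen B →₀ DiffOp K O)
    (hm : m ∈ freeGr K O DiscGen.deg n) : discH B m ∈ freeGr K O DiscGen.deg (n + 1) := by
  refine freeGr_induction (p := fun m => discH B m ∈ freeGr K O DiscGen.deg (n + 1))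
    (by simp) (fun x y h h' => by rw [map_add]; exact Submodule.add_mem _ h h') ?_ m hm
  rintro (⟨k, b⟩ | ⟨k, b⟩) P h
  · rw [discH_top]; exact Submodule.zero_mem _
  · rw [discH_bot]
    obtain rfl : k = n := h
    exact single_mem_freeGr (deg := DiscGen.deg) (.top k b) P

/-- On each generator exactly one of the two composites is the identity and the other is zero: `h d`
acts on `𝕀_b` and `d h` on `s⁻¹𝕀_b`. -/
theorem discD_discH (B : GDA K O) (m : DiscGen B →₀ DiffOp K O) :
    discD B (discH B m) + discH B (discD B m) = m := by
  induction m using Finsupp.induction_linear with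
  | zero => simp
  | add x y h h' => simp only [map_add]; rw [add_add_add_comm, h, h']
  | single g P =>
    rcases g with ⟨k, b⟩ | ⟨k, b⟩
    · rw [discH_top, discD_top, discH_bot, map_zero, zero_add]
    · rw [discH_bot, discD_top, discD_bot, map_zero, add_zero]

open Classical in
/-- A well-ordering of the generators of `P(B)` that is compatible with the degree. -/
instance DiscGen.linearOrder (B : GDA K O) : LinearOrder (DiscGen B) :=
  letI := linearOrderOfSTO (WellOrderingRel (α := DiscGen B))
  LinearOrder.lift' (fun g : DiscGen B => toLex (g.deg, g))
    fun _ _ h => congrArg Prod.snd (toLex.injective h)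

-- Degree is the leading coordinate of the lexicographic order. This gives both minimality and the
-- lowering condition, `s⁻¹𝕀_b` lying one degree below `𝕀_b`.
open Classical in
theorem DiscGen.lt_of_deg_lt {B : GDA K O} {g g' : DiscGen B} (h : g.deg < g'.deg) : g < g' := by
  let := linearOrderOfSTO (WellOrderingRel (α := DiscGen B))
  exact Prod.Lex.toLex_lt_toLex.2 (Or.inl h)

theorem DiscGen.deg_le_of_le {B : GDA K O} {g g' : DiscGen B} (h : g ≤ g') : g.deg ≤ g'.deg :=
  not_lt.1 fun h' => (lt_of_deg_lt h').not_ge h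

/-- The order is the pullback of a lexicographic product of two well-founded relations, the usual
order of degrees and an arbitrary well-ordering of the generators. -/
instance DiscGen.wellFoundedLT (B : GDA K O) : WellFoundedLT (DiscGen B) := by
  refine ⟨?_⟩
  have hw : WellFounded (Prod.Lex (· < · : ℕ → ℕ → Prop) (WellOrderingRel (α := DiscGen B))) :=
    WellFounded.prod_lex wellFounded_lt WellOrderingRel.isWellOrder.wf
  exact InvImage.wf (fun g : DiscGen B => (g.deg, g)) hw

variable (A : DGDA K O) (B : GDA K O)

theorem diff_gen_top (n : ℕ) (b : B.gr (n + 1)) :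
    (A.tensor (discs B).sym).diff.d (gen A.toGDA DiscGen.deg (DiscGen.top n b)) =
      gen A.toGDA DiscGen.deg (DiscGen.bot n b) := by
  refine (Tens.diff_tmul A.diff.d (discs B).sym.diff.d SetLike.GradedOne.one_mem _).trans ?_
  rw [A.diff.d_one, Tens.zero_tmul, zero_add, pow_zero, one_smul, GSym.symD_ι]
  congr 2
  exact discD_top B n b 1

theorem diff_gen_bot (n : ℕ) (b : B.gr (n + 1)) :
    (A.tensor (discs B).sym).diff.d (gen A.toGDA DiscGen.deg (DiscGen.bot n b)) = 0 := by
  refine (Tens.diff_tmul A.diff.d (discs B).sym.diff.d SetLike.GradedOne.one_mem _).trans ?_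
  rw [A.diff.d_one, Tens.zero_tmul, zero_add, pow_zero, one_smul, GSym.symD_ι]
  refine (congrArg _ ?_).trans (Tens.tmul_zero _)
  exact (congrArg _ (discD_bot B n b 1)).trans (map_zero _)

/-- The relative Sullivan `𝒟`-algebra `A → A ⊗ 𝒮(P(B))`. -/
def discsRelSullivan : RelSullivan (DGDA.inl A (discs B).sym) where
  J := DiscGen B
  deg := DiscGen.deg
  e := ⟨AlgHom.id O _, fun _ _ h => h, fun _ _ => rfl⟩
  bijective := Function.bijective_id
  e_inl _ := rfl
  lowering α := by
    rcases α with ⟨n, b⟩ | ⟨n, b⟩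
    · refine ⟨gen A.toGDA DiscGen.deg (DiscGen.bot n b), ?_, diff_gen_top A B n b⟩
      exact Submodule.subset_span ⟨1, _, Algebra.subset_adjoin
        ⟨.bot n b, DiscGen.lt_of_deg_lt (Nat.lt_succ_self n), 1, rfl⟩, rfl⟩
    · exact ⟨0, Submodule.zero_mem _, diff_gen_bot A B n b⟩

theorem discsRelSullivan_isMinimal : (discsRelSullivan A B).IsMinimal :=
  fun _ _ => DiscGen.deg_le_of_le

theorem discsRelSullivan_isSplit : (discsRelSullivan A B).IsSplit :=
  ⟨(discs B).sym.diff, fun _ => rfl⟩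

/-- The map of generators induced by a morphism. -/
def DiscGen.map {B B' : GDA K O} (f : GDA.Hom B B') : DiscGen B → DiscGen B'
  | .top n b => .top n ⟨f.toAlgHom b, f.map_mem _ _ b.2⟩
  | .bot n b => .bot n ⟨f.toAlgHom b, f.map_mem _ _ b.2⟩

theorem DiscGen.deg_map {B B' : GDA K O} (f : GDA.Hom B B') (g : DiscGen B) :
    (g.map f).deg = g.deg := by
  cases g <;> rfl

/-- The images of the generators of `P(B)` in `B`. -/
def DiscGen.eval {B : DGDA K O} : DiscGen B.toGDA → B.carrier
  | .top _ b => b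
  | .bot _ b => B.diff.d b

theorem DiscGen.eval_mem {B : DGDA K O} (g : DiscGen B.toGDA) : g.eval ∈ B.gr g.deg := by
  rcases g with ⟨n, b⟩ | ⟨n, b⟩
  · exact b.2
  · exact B.diff.isDifferential.map_succ n _ b.2

/-- On the lower generators this is the compatibility of `f` with the differentials. It yields the
naturality of the projection to `B`. -/
theorem DiscGen.eval_map {B B' : DGDA K O} (f : B ⟶ B') (g : DiscGen B.toGDA) :
    (g.map f.toHom).eval = f.toAlgHom g.eval := by
  rcases g with ⟨n, b⟩ | ⟨n, b⟩
  · rfl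
  · exact (f.map_d b).symm

theorem DGDA.comp_toAlgHom {A B C : DGDA K O} (f : A ⟶ B) (g : B ⟶ C) (a : A.carrier) :
    (f ≫ g).toAlgHom a = g.toAlgHom (f.toAlgHom a) := rfl

theorem DGDA.hom_ext {A B : DGDA K O} {f g : A ⟶ B} (h : ∀ a, f.toAlgHom a = g.toAlgHom a) :
    f = g := by
  rcases f with ⟨⟨f, _, _⟩, _⟩
  rcases g with ⟨⟨g, _, _⟩, _⟩
  obtain rfl : f = g := AlgHom.ext h
  rfl

end Discs

/-! ### The functorial factorization. -/

section Factorization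

variable {K : Type v} {O : Type u} [Field K] [CharZero K] [CommRing O] [Algebra K O]
  [Algebra.Smooth K O]

/-- The morphism `A ⊗ 𝒮(P(B)) → A' ⊗ 𝒮(P(B'))` induced by morphisms `A → A'` and `B → B'`. -/
def discsMap {A A' B B' : DGDA K O} (f : A ⟶ A') (g : B ⟶ B') :
    A.tensor (discs B.toGDA).sym ⟶ A'.tensor (discs B'.toGDA).sym :=
  discsLift (f ≫ DGDA.inl A' (discs B'.toGDA).sym)
    (fun j => gen A'.toGDA DiscGen.deg (j.map g.toHom))
    (fun j => DiscGen.deg_map g.toHom j ▸ gen_mem A'.toGDA DiscGen.deg _)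
    (fun n _ => diff_gen_top A' B'.toGDA n _) (fun n _ => diff_gen_bot A' B'.toGDA n _)

theorem discsMap_inl {A A' B B' : DGDA K O} (f : A ⟶ A') (g : B ⟶ B') (a : A.carrier) :
    (discsMap f g).toAlgHom (A.tmul (discs B.toGDA).sym.toGDA a 1) =
      A'.tmul (discs B'.toGDA).sym.toGDA (f.toAlgHom a) 1 :=
  discsLift_inl _ _ _ _ _ a

theorem discsMap_gen {A A' B B' : DGDA K O} (f : A ⟶ A') (g : B ⟶ B') (j : DiscGen B.toGDA) :
    (discsMap f g).toAlgHom (gen A.toGDA DiscGen.deg j) =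
      gen A'.toGDA DiscGen.deg (j.map g.toHom) :=
  discsLift_gen _ _ _ _ _ j

/-- The morphism `A ⊗ 𝒮(P(B)) → B` induced by `φ : A → B`, `𝕀_b ↦ b` and `s⁻¹𝕀_b ↦ d b`. -/
def discsProj {A B : DGDA K O} (φ : A ⟶ B) : A.tensor (discs B.toGDA).sym ⟶ B :=
  discsLift φ DiscGen.eval DiscGen.eval_mem (fun _ _ => rfl)
    (fun _ b => B.diff.isDifferential.sq b)

theorem discsProj_inl {A B : DGDA K O} (φ : A ⟶ B) (a : A.carrier) :
    (discsProj φ).toAlgHom (A.tmul (discs B.toGDA).sym.toGDA a 1) = φ.toAlgHom a :=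
  discsLift_inl _ _ _ _ _ a

theorem discsProj_gen {A B : DGDA K O} (φ : A ⟶ B) (j : DiscGen B.toGDA) :
    (discsProj φ).toAlgHom (gen A.toGDA DiscGen.deg j) = j.eval :=
  discsLift_gen _ _ _ _ _ j

/-- The generator `𝕀_b` is a preimage of `b`. Such a generator exists exactly in positive degrees,
which is why surjectivity is not obtained in degree zero. -/
theorem fibrations_discsProj {A B : DGDA K O} (φ : A ⟶ B) : fibrations K O (discsProj φ) := by
  rintro (_ | n) hn b hb
  · exact absurd hn (lt_irrefl 0)
  · exact ⟨_, gen_mem A.toGDA DiscGen.deg (DiscGen.top n ⟨b, hb⟩), discsProj_gen φ _⟩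

variable (K O) in
/-- The functor `(φ : A → B) ↦ A ⊗ 𝒮(P(B))`. -/
def discsFunctor : Arrow (DGDA K O) ⥤ DGDA K O where
  obj φ := φ.left.tensor (discs φ.right.toGDA).sym
  map s := discsMap s.left s.right
  map_id φ := by
    refine discs_hom_ext (fun a => discsMap_inl _ _ a) fun j => (discsMap_gen _ _ j).trans ?_
    cases j <;> rfl
  map_comp s t := by
    refine discs_hom_ext (fun a => ?_) fun j => ?_
    · rw [DGDA.comp_toAlgHom, discsMap_inl, discsMap_inl, discsMap_inl]; rfl
    · rw [DGDA.comp_toAlgHom, discsMap_gen, discsMap_gen, discsMap_gen]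
      cases j <;> rfl

variable (K O) in
/-- The functorial factorization `A → A ⊗ 𝒮(P(B)) → B`. -/
def discsFactorization :
    (weakEquivalences K O ⊓ splitMinimalSullivan K O).FunctorialFactorizationData
      (fibrations K O) where
  Z := discsFunctor K O
  i :=
    { app := fun φ => DGDA.inl φ.left (discs φ.right.toGDA).sym
      naturality := fun φ ψ s => DGDA.hom_ext fun a => (discsMap_inl s.left s.right a).symm }
  p :=
    { app := fun φ => discsProj φ.hom
      naturality := fun φ ψ s => by
        refine discs_hom_ext (fun a => ?_) fun j => ?_
        · refine (congrArg (discsProj ψ.hom).toAlgHom (discsMap_inl s.left s.right a)).trans ?_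
          refine (discsProj_inl ψ.hom _).trans ?_
          refine Eq.trans ?_ (congrArg s.right.toAlgHom (discsProj_inl φ.hom a)).symm
          exact congrArg (fun f : φ.left ⟶ ψ.right => f.toAlgHom a) s.w
        · refine (congrArg (discsProj ψ.hom).toAlgHom (discsMap_gen s.left s.right j)).trans ?_
          refine (discsProj_gen ψ.hom _).trans ?_
          refine Eq.trans ?_ (congrArg s.right.toAlgHom (discsProj_gen φ.hom j)).symm
          exact DiscGen.eval_map s.right j }
  fac := by
    ext φ
    exact DGDA.hom_ext fun a => discsProj_inl φ.hom a
  hi φ := ⟨weakEquivalences_inl (discH_mem φ.right.toGDA) (discD_discH φ.right.toGDA),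
    discsRelSullivan _ _, discsRelSullivan_isMinimal _ _, discsRelSullivan_isSplit _ _⟩
  hp φ := fibrations_discsProj φ.hom

end Factorization

end

end DAlg

theorem mainTheorem3 (K : Type v) (O : Type u) [Field K] [IsAlgClosed K] [CharZero K]
    [CommRing O] [Algebra K O] [Algebra.Smooth K O] :
    ∃ F : (DAlg.weakEquivalences K O ⊓
        DAlg.splitMinimalSullivan K O).FunctorialFactorizationData (DAlg.fibrations K O),
      ∀ (A B : DAlg.DGDA K O) (φ : A ⟶ B),
        (∃ e : F.Z.obj (Arrow.mk φ) ≅ A.tensor (DAlg.discs B.toGDA).sym,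
          F.i.app (Arrow.mk φ) ≫ e.hom = DAlg.DGDA.inl A (DAlg.discs B.toGDA).sym) ∧
        ∃ R : DAlg.RelSullivan (DAlg.DGDA.inl A (DAlg.discs B.toGDA).sym),
          R.IsMinimal ∧ R.IsSplit ∧
            ∃ σ : R.J ≃ DAlg.DiscGen B.toGDA, ∀ α : R.J, R.deg α = (σ α).deg ∧
              R.e.toAlgHom (DAlg.GDA.tmul A.toGDA (DAlg.freeGDM K O R.J R.deg).sym 1
                  (DAlg.GSym.ι _ (Finsupp.single α 1))) =
                DAlg.GDA.tmul A.toGDA (DAlg.discs B.toGDA).sym.toGDA 1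
                  (DAlg.GSym.ι _ (Finsupp.single (σ α) 1)) := by
  -- The factorization has `A ⊗ 𝒮(P(B))` itself as its middle object and the generators of `P(B)` as
  -- its Sullivan basis, so the isomorphism and the bijection of bases are identities.
  refine ⟨DAlg.discsFactorization K O, fun A B φ => ⟨⟨Iso.refl _, Category.comp_id _⟩,
    DAlg.discsRelSullivan A B.toGDA, DAlg.discsRelSullivan_isMinimal A B.toGDA,
    DAlg.discsRelSullivan_isSplit A B.toGDA, Equiv.refl _, fun α => ⟨rfl, rfl⟩⟩⟩
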